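/- Let $k$ be a field; all operads are symmetric $k$-linear operads. For a unary-binary operad $\mathcal Q=\mathcal F(W)/(S)$ presented by a space $W_1$ of unary generators with basis $\Omega$, a space $W_2$ of binary generators with a basis $\Theta$ stable under $\theta\mapsto\theta':=\theta^{(12)}$, and relators $S$, let $V$ be the $S_2$-module with basis $\{\prec_{\omega,\theta},\succ_{\omega,\theta}\mid\omega\in\Omega,\theta\in\Theta\}$ and action $\prec_{\omega,\theta}^{(12)}=\succ_{\omega,\theta'}$, $\succ_{\omega,\theta}^{(12)}=\prec_{\omega,\theta'}$. Let $\Phi:\mathcal F(V)\to\mathcal Q$ be the operad morphism with $\prec_{\omega,\theta}\mapsto\theta(\mathrm{id}\otimes\omega)$ and $\succ_{\omega,\theta}\mapsto\theta(\omega\otimes\mathrm{id})$. The pre-induced operad of $\mathcal Q$ is $\mathcal F(V)/(R)$, where $R:=\ker\Phi\cap\mathcal F(V)(3)$. Let $\mathcal D$ be the operad of commutative differential algebras, generated by one unary operation $D$ and one symmetric binary operation, with relators $(xy)z-x(yz)$, $xy-yx$ and $D(xy)-xD(y)-D(x)y$; here $\Omega=\{D\}$, $\Theta$ is the one-element set consisting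 of the product, and we write $\prec,\succ$ for the two generators. Let $V_N$ be the $S_2$-module with basis $\{\rhd,\rhd'\}$ and $\rhd^{(12)}=\rhd'$, let $R_N\subseteq\mathcal F(V_N)(3)$ be the $kS_3$-submodule generated by $$(x\rhd y)\rhd z-x\rhd(y\rhd z)-(y\rhd x)\rhd z+y\rhd(x\rhd z)\quad\text{and}\quad (x\rhd y)\rhd z-(x\rhd z)\rhd y,$$ and let $\mathcal N:=\mathcal F(V_N)/(R_N)$ be the operad of Novikov algebras. **Corollary.** The operad $\mathcal N$ is the pre-induced operad of $\mathcal D$. More precisely: 1. Under the identification $\rhd\leftrightarrow\,\prec$, $\rhd'\leftrightarrow\,\succ$ one has $R_N=\ker\Phi\cap\mathcal F(V)(3)$ for $\mathcal Q=\mathcal D$. 2. There is an isomorphism of operads from $\mathcal N$ to the pre-induced operad of $\mathcal D$ that sends the class of $\rhd$ to that of $\prec$ and the class of $\rhd'$ to that of $\succ$. 3. Every binary quadratic relation induced by $a\rhd b:=a\,D(b)$ is a consequence of the two Novikov axioms: an element $r\in\mathcal F(V_N)(3)$ lies in $R_N$ if and only if for every commutative associative (not necessarily unital) $k$-algebra $A$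 and every derivation $D$ of $A$, $r$ vanishes identically on $A$ with the product $a\rhd b:=a\,D(b)$. -/

import Mathlib

/-! Symmetric operads given by partial compositions, free unary-binary operads on trees,
presented operads, and the pre-induced operad of a presented unary-binary operad. -/

universe u v w

noncomputable section

namespace InducedOperad

/-! ### Symmetric operads -/

/-- In a partial composition `μ ∘ᵢ ν` of an operation `μ` of arity `m` with an operation `ν` of
arity `n` (the result has arity `p = m + n - 1`), the input of `μ ∘ᵢ ν` that comes from the input
`j ≠ i` of `μ`. All inputs are numbered from `0`. -/
def outer {m n p : ℕ} (h : p + 1 = m + n) (i j : Fin m) (hj : j ≠ i) : Fin p :=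
  ⟨if j < i then (j : ℕ) else (j : ℕ) + n - 1, by
    have h1 := i.isLt
    have h2 := j.isLt
    have h3 : (j : ℕ) ≠ (i : ℕ) := fun e => hj (Fin.ext e)
    split_ifs with h4
    · have h5 : (j : ℕ) < (i : ℕ) := h4
      omega
    · have h5 : ¬ (j : ℕ) < (i : ℕ) := h4
      omega⟩

/-- The input of `μ ∘ᵢ ν` that comes from the input `l` of `ν`. -/
def inner {m n p : ℕ} (h : p + 1 = m + n) (i : Fin m) (l : Fin n) : Fin p :=
  ⟨(i : ℕ) + (l : ℕ), by
    have h1 := i.isLt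
    have h2 := l.isLt
    omega⟩

/-- A symmetric linear operad over `k`: right `k Sₙ`-modules `P(n)`, `n ≥ 0`, with an identity
in `P(1)` and partial compositions `∘ᵢ : P(m) ⊗ P(n) → P(m + n - 1)`. The arity of the result
is a separate variable `p` with `p + 1 = m + n`, so that no transport between equal arities is
needed. -/
structure Operad (k : Type u) [CommRing k] where
  carrier : ℕ → Type v
  [instAddCommGroup : ∀ n, AddCommGroup (carrier n)]
  [instModule : ∀ n, Module k (carrier n)]
  /-- `act σ μ` is `μ ^ σ`: the input `j` of `μ ^ σ` is the input `σ j` of `μ`. -/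
  act : ∀ {n : ℕ}, Equiv.Perm (Fin n) → carrier n →ₗ[k] carrier n
  /-- `comp h i μ ν` is `μ ∘ᵢ ν`. -/
  comp : ∀ {m n p : ℕ}, p + 1 = m + n → Fin m → carrier m →ₗ[k] carrier n →ₗ[k] carrier p
  one : carrier 1
  act_one : ∀ {n : ℕ} (μ : carrier n), act 1 μ = μ
  act_mul : ∀ {n : ℕ} (σ τ : Equiv.Perm (Fin n)) (μ : carrier n),
    act (σ * τ) μ = act τ (act σ μ)
  comp_assoc : ∀ {l m n p q r : ℕ} (h₁ : p + 1 = l + m) (h₂ : r + 1 = p + n)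
    (h₃ : q + 1 = m + n) (h₄ : r + 1 = l + q) (i : Fin l) (j : Fin m)
    (η : carrier l) (μ : carrier m) (ν : carrier n),
    comp h₂ (inner h₁ i j) (comp h₁ i η μ) ν = comp h₄ i η (comp h₃ j μ ν)
  comp_comm : ∀ {l m n p q r : ℕ} (h₁ : p + 1 = l + m) (h₂ : r + 1 = p + n)
    (h₃ : q + 1 = l + n) (h₄ : r + 1 = q + m) (i j : Fin l) (hij : i < j)
    (η : carrier l) (μ : carrier m) (ν : carrier n),
    comp h₂ (outer h₁ i j hij.ne') (comp h₁ i η μ) ν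
      = comp h₄ (outer h₃ j i hij.ne) (comp h₃ j η ν) μ
  one_comp : ∀ {n : ℕ} (h : n + 1 = 1 + n) (μ : carrier n), comp h 0 one μ = μ
  comp_one : ∀ {m : ℕ} (h : m + 1 = m + 1) (i : Fin m) (μ : carrier m), comp h i μ one = μ
  act_comp : ∀ {m n p : ℕ} (h : p + 1 = m + n) (i : Fin m) (σ : Equiv.Perm (Fin m))
    (σ' : Equiv.Perm (Fin p)),
    (∀ (j : Fin m) (hj : j ≠ i),
      σ' (outer h i j hj) = outer h (σ i) (σ j) (σ.injective.ne hj)) →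
    (∀ l : Fin n, σ' (inner h i l) = inner h (σ i) l) →
    ∀ (μ : carrier m) (ν : carrier n), comp h i (act σ μ) ν = act σ' (comp h (σ i) μ ν)
  comp_act : ∀ {m n p : ℕ} (h : p + 1 = m + n) (i : Fin m) (τ : Equiv.Perm (Fin n))
    (τ' : Equiv.Perm (Fin p)),
    (∀ (j : Fin m) (hj : j ≠ i), τ' (outer h i j hj) = outer h i j hj) →
    (∀ l : Fin n, τ' (inner h i l) = inner h i (τ l)) →
    ∀ (μ : carrier m) (ν : carrier n), comp h i μ (act τ ν) = act τ' (comp h i μ ν)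

attribute [instance] Operad.instAddCommGroup Operad.instModule

section

variable {k : Type u} [CommRing k]

/-- Morphisms of operads. -/
structure Hom (P : Operad.{u, v} k) (Q : Operad.{u, w} k) where
  toFun : ∀ n : ℕ, P.carrier n →ₗ[k] Q.carrier n
  map_one : toFun 1 P.one = Q.one
  map_act : ∀ {n : ℕ} (σ : Equiv.Perm (Fin n)) (μ : P.carrier n),
    toFun n (P.act σ μ) = Q.act σ (toFun n μ)
  map_comp : ∀ {m n p : ℕ} (h : p + 1 = m + n) (i : Fin m) (μ : P.carrier m) (ν : P.carrier n),
    toFun p (P.comp h i μ ν) = Q.comp h i (toFun m μ) (toFun n ν)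

/-- Isomorphisms of operads are the morphisms that are bijective in each arity. -/
def Hom.IsIso {P : Operad.{u, v} k} {Q : Operad.{u, w} k} (f : Hom P Q) : Prop :=
  ∀ n : ℕ, Function.Bijective (f.toFun n)

universe w' in
def Hom.trans {P : Operad.{u, v} k} {Q : Operad.{u, w} k} {R : Operad.{u, w'} k}
    (f : Hom P Q) (g : Hom Q R) : Hom P R where
  toFun n := (g.toFun n).comp (f.toFun n)
  map_one := by simp [f.map_one, g.map_one]
  map_act σ μ := by simp [f.map_act, g.map_act]
  map_comp h i μ ν := by simp [f.map_comp, g.map_comp]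

/-- Operadic ideals. -/
structure OpIdeal (P : Operad.{u, v} k) where
  sub : ∀ n : ℕ, Submodule k (P.carrier n)
  act_mem : ∀ {n : ℕ} (σ : Equiv.Perm (Fin n)) (μ : P.carrier n), μ ∈ sub n → P.act σ μ ∈ sub n
  comp_mem_left : ∀ {m n p : ℕ} (h : p + 1 = m + n) (i : Fin m) (μ : P.carrier m)
    (ν : P.carrier n), μ ∈ sub m → P.comp h i μ ν ∈ sub p
  comp_mem_right : ∀ {m n p : ℕ} (h : p + 1 = m + n) (i : Fin m) (μ : P.carrier m)
    (ν : P.carrier n), ν ∈ sub n → P.comp h i μ ν ∈ sub p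

/-- The operadic ideal `(S)` generated by a set `S` of operations of any arities: the
intersection of all operadic ideals that contain `S`. -/
def OpIdeal.span (P : Operad.{u, v} k) (S : Set (Σ n : ℕ, P.carrier n)) : OpIdeal P where
  sub n := ⨅ I : {I : OpIdeal P // ∀ s ∈ S, s.2 ∈ I.sub s.1}, I.1.sub n
  act_mem σ μ hμ := by
    rw [Submodule.mem_iInf] at hμ ⊢
    exact fun I => I.1.act_mem σ μ (hμ I)
  comp_mem_left h i μ ν hμ := by
    rw [Submodule.mem_iInf] at hμ ⊢
    exact fun I => I.1.comp_mem_left h i μ ν (hμ I)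
  comp_mem_right h i μ ν hν := by
    rw [Submodule.mem_iInf] at hν ⊢
    exact fun I => I.1.comp_mem_right h i μ ν (hν I)

/-- The quotient of an operad by an operadic ideal. -/
def Operad.quot (P : Operad.{u, v} k) (I : OpIdeal P) : Operad.{u, v} k where
  carrier n := P.carrier n ⧸ I.sub n
  act σ := (I.sub _).mapQ (I.sub _) (P.act σ) (fun μ hμ => I.act_mem σ μ hμ)
  comp {m n p} h i := (I.sub m).liftQ
    ((Submodule.mapQLinear (I.sub n) (I.sub p)).comp
      (LinearMap.codRestrict (Submodule.compatibleMaps (I.sub n) (I.sub p)) (P.comp h i)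
        (fun μ ν hν => I.comp_mem_right h i μ ν hν)))
    (by
      intro μ hμ
      rw [LinearMap.mem_ker]
      ext ν
      exact (Submodule.Quotient.mk_eq_zero _).2 (I.comp_mem_left h i μ ν hμ))
  one := Submodule.Quotient.mk P.one
  act_one μ := by
    obtain ⟨μ, rfl⟩ := Submodule.Quotient.mk_surjective _ μ
    exact congrArg Submodule.Quotient.mk (P.act_one μ)
  act_mul σ τ μ := by
    obtain ⟨μ, rfl⟩ := Submodule.Quotient.mk_surjective _ μ
    exact congrArg Submodule.Quotient.mk (P.act_mul σ τ μ)
  comp_assoc h₁ h₂ h₃ h₄ i j η μ ν := by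
    obtain ⟨η, rfl⟩ := Submodule.Quotient.mk_surjective _ η
    obtain ⟨μ, rfl⟩ := Submodule.Quotient.mk_surjective _ μ
    obtain ⟨ν, rfl⟩ := Submodule.Quotient.mk_surjective _ ν
    exact congrArg Submodule.Quotient.mk (P.comp_assoc h₁ h₂ h₃ h₄ i j η μ ν)
  comp_comm h₁ h₂ h₃ h₄ i j hij η μ ν := by
    obtain ⟨η, rfl⟩ := Submodule.Quotient.mk_surjective _ η
    obtain ⟨μ, rfl⟩ := Submodule.Quotient.mk_surjective _ μ
    obtain ⟨ν, rfl⟩ := Submodule.Quotient.mk_surjective _ ν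
    exact congrArg Submodule.Quotient.mk (P.comp_comm h₁ h₂ h₃ h₄ i j hij η μ ν)
  one_comp h μ := by
    obtain ⟨μ, rfl⟩ := Submodule.Quotient.mk_surjective _ μ
    exact congrArg Submodule.Quotient.mk (P.one_comp h μ)
  comp_one h i μ := by
    obtain ⟨μ, rfl⟩ := Submodule.Quotient.mk_surjective _ μ
    exact congrArg Submodule.Quotient.mk (P.comp_one h i μ)
  act_comp h i σ σ' h₁ h₂ μ ν := by
    obtain ⟨μ, rfl⟩ := Submodule.Quotient.mk_surjective _ μ
    obtain ⟨ν, rfl⟩ := Submodule.Quotient.mk_surjective _ ν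
    exact congrArg Submodule.Quotient.mk (P.act_comp h i σ σ' h₁ h₂ μ ν)
  comp_act h i τ τ' h₁ h₂ μ ν := by
    obtain ⟨μ, rfl⟩ := Submodule.Quotient.mk_surjective _ μ
    obtain ⟨ν, rfl⟩ := Submodule.Quotient.mk_surjective _ ν
    exact congrArg Submodule.Quotient.mk (P.comp_act h i τ τ' h₁ h₂ μ ν)

/-- The quotient morphism. -/
def Operad.mkQ (P : Operad.{u, v} k) (I : OpIdeal P) : Hom P (P.quot I) where
  toFun n := (I.sub n).mkQ
  map_one := rfl
  map_act _ _ := rfl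
  map_comp _ _ _ _ := rfl

end

/-! ### Free operads on unary and binary generators -/

/-- A basis of an `𝕊`-module concentrated in arities one and two: a set `Un` of unary generators
and a set `Bin` of binary generators, the latter with the action `θ ↦ θ ^ (12)` of the nontrivial
element of `S₂`. -/
structure Sig where
  Un : Type v
  Bin : Type v
  swap : Bin → Bin
  swap_swap : ∀ θ, swap (swap θ) = θ

/-- Planar trees with vertices decorated by generators and leaves decorated by `L`. -/
inductive Tree (S : Sig.{v}) (L : Type) : Type v where
  | leaf : L → Tree S L
  | un : S.Un → Tree S L → Tree S L
  | bin : S.Bin → Tree S L → Tree S L → Tree S L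

namespace Tree

variable {S : Sig.{v}} {T : Sig.{w}} {L M N : Type}

/-- Grafting of a tree on each leaf. -/
def bind (f : L → Tree S M) : Tree S L → Tree S M
  | leaf l => f l
  | un ω t => un ω (t.bind f)
  | bin θ t s => bin θ (t.bind f) (s.bind f)

/-- Relabelling of the leaves. -/
def map (f : L → M) (t : Tree S L) : Tree S M := t.bind (fun l => leaf (f l))

def leaves : Tree S L → List L
  | leaf l => [l]
  | un _ t => t.leaves
  | bin _ t s => t.leaves ++ s.leaves

theorem bind_bind (f : L → Tree S M) (g : M → Tree S N) (t : Tree S L) :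
    (t.bind f).bind g = t.bind (fun l => (f l).bind g) := by
  induction t with
  | leaf l => rfl
  | un ω t ih => simp [bind, ih]
  | bin θ t s iht ihs => simp [bind, iht, ihs]

theorem bind_leaf (t : Tree S L) : t.bind leaf = t := by
  induction t with
  | leaf l => rfl
  | un ω t ih => simp [bind, ih]
  | bin θ t s iht ihs => simp [bind, iht, ihs]

theorem leaves_bind (f : L → Tree S M) (t : Tree S L) :
    (t.bind f).leaves = t.leaves.flatMap (fun l => (f l).leaves) := by
  induction t with
  | leaf l => simp [bind, leaves]
  | un ω t ih => simp [bind, leaves, ih]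
  | bin θ t s iht ihs => simp [bind, leaves, iht, ihs]

theorem leaves_map (f : L → M) (t : Tree S L) : (t.map f).leaves = t.leaves.map f := by
  simp [map, leaves_bind, leaves, List.map_eq_flatMap]

/-- Each label decorates exactly one leaf. -/
def IsLabelled (t : Tree S L) : Prop := t.leaves.Nodup ∧ ∀ l : L, l ∈ t.leaves

theorem IsLabelled.bind {t : Tree S L} (ht : t.IsLabelled) {f : L → Tree S M}
    (h₁ : ∀ l, (f l).leaves.Nodup) (h₂ : ∀ l l', l ≠ l' → (f l).leaves.Disjoint (f l').leaves)
    (h₃ : ∀ a : M, ∃ l, a ∈ (f l).leaves) : (t.bind f).IsLabelled := by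
  unfold IsLabelled
  rw [leaves_bind]
  refine ⟨List.nodup_flatMap.2 ⟨fun l _ => h₁ l, ?_⟩, fun a => ?_⟩
  · exact List.Pairwise.imp (fun {a b} hab => h₂ a b hab) ht.1
  · obtain ⟨l, hl⟩ := h₃ a
    exact List.mem_flatMap.2 ⟨l, ht.2 l, hl⟩

/-- Two planar trees are equivalent if they differ by exchanging the two branches at some
binary vertices `θ` while replacing `θ` by `θ ^ (12)`. -/
inductive Equivalent : Tree S L → Tree S L → Prop
  | refl (t) : Equivalent t t
  | symm {t s} : Equivalent t s → Equivalent s t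
  | trans {t s r} : Equivalent t s → Equivalent s r → Equivalent t r
  | un (ω) {t s} : Equivalent t s → Equivalent (Tree.un ω t) (Tree.un ω s)
  | bin (θ) {t t' s s'} : Equivalent t t' → Equivalent s s' →
      Equivalent (Tree.bin θ t s) (Tree.bin θ t' s')
  | swap (θ) (t s) : Equivalent (Tree.bin θ t s) (Tree.bin (S.swap θ) s t)

theorem Equivalent.bind_left {t s : Tree S L} (h : Equivalent t s) (f : L → Tree S M) :
    Equivalent (t.bind f) (s.bind f) := by
  induction h with
  | refl t => exact .refl _
  | symm _ ih => exact .symm ih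
  | trans _ _ ih₁ ih₂ => exact .trans ih₁ ih₂
  | un ω _ ih => exact .un ω ih
  | bin θ _ _ ih₁ ih₂ => exact .bin θ ih₁ ih₂
  | swap θ t s => exact .swap θ _ _

theorem Equivalent.bind_right (t : Tree S L) {f g : L → Tree S M}
    (h : ∀ l, Equivalent (f l) (g l)) : Equivalent (t.bind f) (t.bind g) := by
  induction t with
  | leaf l => exact h l
  | un ω _ ih => exact .un ω ih
  | bin θ _ _ ih₁ ih₂ => exact .bin θ ih₁ ih₂

/-- The partial composition of labelled trees: grafting of `s` on the leaf `i` of `t`. -/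
def graft {m n p : ℕ} (h : p + 1 = m + n) (i : Fin m) (t : Tree S (Fin m)) (s : Tree S (Fin n)) :
    Tree S (Fin p) :=
  t.bind (fun j => if hj : j = i then s.map (inner h i) else leaf (outer h i j hj))

end Tree

section positions

variable {m n p : ℕ} (h : p + 1 = m + n) (i : Fin m)

theorem inner_inj {l l' : Fin n} (e : inner h i l = inner h i l') : l = l' := by
  simp only [inner, Fin.mk.injEq] at e
  exact Fin.ext (by omega)

theorem outer_inj {j j' : Fin m} (hj : j ≠ i) (hj' : j' ≠ i)
    (e : outer h i j hj = outer h i j' hj') : j = j' := by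
  have h1 : (j : ℕ) ≠ i := fun e => hj (Fin.ext e)
  have h2 : (j' : ℕ) ≠ i := fun e => hj' (Fin.ext e)
  simp only [outer, Fin.mk.injEq, Fin.lt_def] at e
  apply Fin.ext
  split_ifs at e <;> omega

theorem outer_ne_inner {j : Fin m} (hj : j ≠ i) (l : Fin n) : outer h i j hj ≠ inner h i l := by
  intro e
  have h1 : (j : ℕ) ≠ i := fun e => hj (Fin.ext e)
  have h2 := l.isLt
  simp only [outer, inner, Fin.mk.injEq, Fin.lt_def] at e
  split_ifs at e <;> omega

theorem position_cases (a : Fin p) :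
    (∃ l : Fin n, a = inner h i l) ∨ ∃ (j : Fin m) (hj : j ≠ i), a = outer h i j hj := by
  have ha := a.isLt
  have hi := i.isLt
  by_cases h1 : (a : ℕ) < i
  · refine Or.inr ⟨⟨a, by omega⟩, fun e => ?_, ?_⟩
    · have := congrArg Fin.val e
      simp only at this
      omega
    · apply Fin.ext
      simp only [outer, Fin.lt_def]
      rw [if_pos h1]
  · by_cases h2 : (a : ℕ) < i + n
    · exact Or.inl ⟨⟨a - i, by omega⟩, Fin.ext (by simp only [inner]; omega)⟩
    · refine Or.inr ⟨⟨a + 1 - n, by omega⟩, fun e => ?_, ?_⟩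
      · have := congrArg Fin.val e
        simp only at this
        omega
      · apply Fin.ext
        simp only [outer, Fin.lt_def]
        rw [if_neg (by omega)]
        omega

end positions

section nested

variable {l m n p q r : ℕ}

theorem inner_inner (h₁ : p + 1 = l + m) (h₂ : r + 1 = p + n) (h₃ : q + 1 = m + n)
    (h₄ : r + 1 = l + q) (i : Fin l) (j : Fin m) (a : Fin n) :
    inner h₂ (inner h₁ i j) a = inner h₄ i (inner h₃ j a) := by
  simp only [inner, Fin.mk.injEq]
  omega

theorem outer_inner (h₁ : p + 1 = l + m) (h₂ : r + 1 = p + n) (h₃ : q + 1 = m + n)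
    (h₄ : r + 1 = l + q) (i : Fin l) (j a : Fin m) (ha : a ≠ j)
    (ha' : inner h₁ i a ≠ inner h₁ i j) :
    outer h₂ (inner h₁ i j) (inner h₁ i a) ha' = inner h₄ i (outer h₃ j a ha) := by
  have h5 : (a : ℕ) ≠ j := fun e => ha (Fin.ext e)
  simp only [inner, outer, Fin.mk.injEq, Fin.lt_def]
  split_ifs <;> omega

theorem outer_outer (h₁ : p + 1 = l + m) (h₂ : r + 1 = p + n) (h₃ : q + 1 = m + n)
    (h₄ : r + 1 = l + q) (i : Fin l) (j : Fin m) (a : Fin l) (ha : a ≠ i)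
    (ha' : outer h₁ i a ha ≠ inner h₁ i j) :
    outer h₂ (inner h₁ i j) (outer h₁ i a ha) ha' = outer h₄ i a ha := by
  have h5 : (a : ℕ) ≠ i := fun e => ha (Fin.ext e)
  have h6 := j.isLt
  simp only [inner, outer, Fin.mk.injEq, Fin.lt_def]
  split_ifs <;> omega

theorem inner_comm (h₁ : p + 1 = l + m) (h₂ : r + 1 = p + n) (h₃ : q + 1 = l + n)
    (h₄ : r + 1 = q + m) (i j : Fin l) (hij : i < j) (a : Fin m)
    (ha : inner h₁ i a ≠ outer h₁ i j hij.ne') :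
    outer h₂ (outer h₁ i j hij.ne') (inner h₁ i a) ha
      = inner h₄ (outer h₃ j i hij.ne) a := by
  have h5 : (i : ℕ) < j := hij
  have h6 := a.isLt
  simp only [inner, outer, Fin.mk.injEq, Fin.lt_def]
  split_ifs <;> omega

theorem inner_comm_symm (h₁ : p + 1 = l + m) (h₂ : r + 1 = p + n) (h₃ : q + 1 = l + n)
    (h₄ : r + 1 = q + m) (i j : Fin l) (hij : i < j) (a : Fin n)
    (ha : inner h₃ j a ≠ outer h₃ j i hij.ne) :
    inner h₂ (outer h₁ i j hij.ne') a
      = outer h₄ (outer h₃ j i hij.ne) (inner h₃ j a) ha := by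
  have h5 : (i : ℕ) < j := hij
  have h6 := a.isLt
  simp only [inner, outer, Fin.mk.injEq, Fin.lt_def]
  split_ifs <;> omega

theorem outer_comm (h₁ : p + 1 = l + m) (h₂ : r + 1 = p + n) (h₃ : q + 1 = l + n)
    (h₄ : r + 1 = q + m) (i j : Fin l) (hij : i < j) (a : Fin l) (ha : a ≠ i) (ha' : a ≠ j)
    (hb : outer h₁ i a ha ≠ outer h₁ i j hij.ne')
    (hb' : outer h₃ j a ha' ≠ outer h₃ j i hij.ne) :
    outer h₂ (outer h₁ i j hij.ne') (outer h₁ i a ha) hb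
      = outer h₄ (outer h₃ j i hij.ne) (outer h₃ j a ha') hb' := by
  have h5 : (i : ℕ) < j := hij
  have h6 : (a : ℕ) ≠ i := fun e => ha (Fin.ext e)
  have h7 : (a : ℕ) ≠ j := fun e => ha' (Fin.ext e)
  simp only [outer, Fin.mk.injEq, Fin.lt_def]
  split_ifs <;> omega

end nested

namespace Tree

variable {S : Sig.{v}}

theorem map_bind {L M N : Type} (f : L → M) (g : M → Tree S N) (t : Tree S L) :
    (t.map f).bind g = t.bind (fun l => g (f l)) := by
  simp only [map, bind_bind, bind]

theorem bind_map {L M N : Type} (f : L → Tree S M) (g : M → N) (t : Tree S L) :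
    (t.bind f).map g = t.bind (fun l => (f l).map g) := by
  simp only [map, bind_bind]

theorem map_map {L M N : Type} (f : L → M) (g : M → N) (t : Tree S L) :
    (t.map f).map g = t.map (fun l => g (f l)) := by
  simp only [map, bind_bind, bind]

theorem graft_assoc {l m n p q r : ℕ} (h₁ : p + 1 = l + m) (h₂ : r + 1 = p + n)
    (h₃ : q + 1 = m + n) (h₄ : r + 1 = l + q) (i : Fin l) (j : Fin m)
    (t : Tree S (Fin l)) (s : Tree S (Fin m)) (z : Tree S (Fin n)) :
    graft h₂ (inner h₁ i j) (graft h₁ i t s) z = graft h₄ i t (graft h₃ j s z) := by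
  unfold graft
  rw [bind_bind]
  congr 1
  funext a
  by_cases ha : a = i
  · simp only [ha, dite_true]
    rw [map_bind, bind_map]
    congr 1
    funext b
    by_cases hb : b = j
    · simp only [hb, dite_true, map_map]
      congr 1
      funext c
      exact inner_inner h₁ h₂ h₃ h₄ i j c
    · have hb' : inner h₁ i b ≠ inner h₁ i j := fun e => hb (inner_inj h₁ i e)
      simp only [hb, hb', dite_false]
      exact congrArg leaf (outer_inner h₁ h₂ h₃ h₄ i j b hb hb')
  · have hb' := outer_ne_inner h₁ i ha j
    simp only [ha, dite_false, bind, hb']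
    exact congrArg leaf (outer_outer h₁ h₂ h₃ h₄ i j a ha hb')

theorem graft_comm {l m n p q r : ℕ} (h₁ : p + 1 = l + m) (h₂ : r + 1 = p + n)
    (h₃ : q + 1 = l + n) (h₄ : r + 1 = q + m) (i j : Fin l) (hij : i < j)
    (t : Tree S (Fin l)) (s : Tree S (Fin m)) (z : Tree S (Fin n)) :
    graft h₂ (outer h₁ i j hij.ne') (graft h₁ i t s) z
      = graft h₄ (outer h₃ j i hij.ne) (graft h₃ j t z) s := by
  unfold graft
  rw [bind_bind, bind_bind]
  congr 1
  funext a
  by_cases ha : a = i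
  · subst ha
    simp only [hij.ne, dite_true, dite_false, bind]
    rw [map_bind]
    unfold map
    congr 1
    funext b
    have hb := (outer_ne_inner h₁ a hij.ne' b).symm
    simp only [hb, dite_false]
    exact congrArg leaf (inner_comm h₁ h₂ h₃ h₄ a j hij b hb)
  · by_cases ha' : a = j
    · subst ha'
      simp only [ha, dite_true, dite_false, bind]
      rw [map_bind]
      unfold map
      congr 1
      funext b
      have hb := (outer_ne_inner h₃ a hij.ne b).symm
      simp only [hb, dite_false]
      exact congrArg leaf (inner_comm_symm h₁ h₂ h₃ h₄ i a hij b hb)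
    · have hb : outer h₁ i a ha ≠ outer h₁ i j hij.ne' := fun e => ha' (outer_inj h₁ i _ _ e)
      have hb' : outer h₃ j a ha' ≠ outer h₃ j i hij.ne := fun e => ha (outer_inj h₃ j _ _ e)
      simp only [ha, ha', dite_false, bind, hb, hb']
      exact congrArg leaf (outer_comm h₁ h₂ h₃ h₄ i j hij a ha ha' hb hb')

theorem leaf_graft {n : ℕ} (h : n + 1 = 1 + n) (t : Tree S (Fin n)) :
    graft h 0 (leaf 0) t = t := by
  have e : inner h 0 = (id : Fin n → Fin n) := by
    funext a
    exact Fin.ext (by simp [inner])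
  simp only [graft, bind, dite_true, map, e, id]
  exact bind_leaf t

theorem graft_leaf {m : ℕ} (h : m + 1 = m + 1) (i : Fin m) (t : Tree S (Fin m)) :
    graft h i t (leaf 0) = t := by
  conv_rhs => rw [← bind_leaf t]
  unfold graft
  congr 1
  funext a
  by_cases ha : a = i
  · simp only [ha, dite_true, map, bind]
    exact congrArg leaf (Fin.ext (by simp [inner]))
  · simp only [ha, dite_false]
    refine congrArg leaf (Fin.ext ?_)
    simp only [outer]
    split_ifs <;> rfl

theorem map_graft {m n p : ℕ} (h : p + 1 = m + n) (i : Fin m) (σ : Equiv.Perm (Fin m))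
    (σ' : Equiv.Perm (Fin p))
    (h₁ : ∀ (j : Fin m) (hj : j ≠ i),
      σ' (outer h i j hj) = outer h (σ i) (σ j) (σ.injective.ne hj))
    (h₂ : ∀ l : Fin n, σ' (inner h i l) = inner h (σ i) l)
    (t : Tree S (Fin m)) (s : Tree S (Fin n)) :
    graft h i (t.map σ.symm) s = (graft h (σ i) t s).map σ'.symm := by
  unfold graft
  rw [map_bind, bind_map]
  congr 1
  funext j
  obtain ⟨j, rfl⟩ := σ.surjective j
  by_cases hj : j = i
  · simp only [hj, Equiv.symm_apply_apply, dite_true, map_map]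
    congr 1
    funext l
    exact σ'.eq_symm_apply.2 (h₂ l)
  · have hj' : σ j ≠ σ i := σ.injective.ne hj
    simp only [hj, hj', Equiv.symm_apply_apply, dite_false, map, bind]
    exact congrArg leaf (σ'.eq_symm_apply.2 (h₁ j hj))

theorem graft_map {m n p : ℕ} (h : p + 1 = m + n) (i : Fin m) (τ : Equiv.Perm (Fin n))
    (τ' : Equiv.Perm (Fin p))
    (h₁ : ∀ (j : Fin m) (hj : j ≠ i), τ' (outer h i j hj) = outer h i j hj)
    (h₂ : ∀ l : Fin n, τ' (inner h i l) = inner h i (τ l))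
    (t : Tree S (Fin m)) (s : Tree S (Fin n)) :
    graft h i t (s.map τ.symm) = (graft h i t s).map τ'.symm := by
  unfold graft
  rw [bind_map]
  congr 1
  funext j
  by_cases hj : j = i
  · simp only [hj, dite_true, map_map]
    congr 1
    funext l
    exact τ'.eq_symm_apply.2 ((h₂ _).trans (congrArg _ (τ.apply_symm_apply l)))
  · simp only [hj, dite_false, map, bind]
    exact congrArg leaf (τ'.eq_symm_apply.2 (h₁ j hj))

theorem IsLabelled.map {n : ℕ} {t : Tree S (Fin n)} (ht : t.IsLabelled)
    (e : Equiv.Perm (Fin n)) : (t.map e).IsLabelled := by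
  refine ht.bind (fun l => ?_) (fun l l' hl => ?_) (fun a => ⟨e.symm a, ?_⟩)
  · simp [leaves]
  · simpa [leaves] using Ne.symm hl
  · simp [leaves]

theorem IsLabelled.graft {m n p : ℕ} (h : p + 1 = m + n) (i : Fin m) {t : Tree S (Fin m)}
    {s : Tree S (Fin n)} (ht : t.IsLabelled) (hs : s.IsLabelled) :
    (graft h i t s).IsLabelled := by
  refine ht.bind (fun j => ?_) (fun j j' hj => ?_) (fun a => ?_)
  · by_cases hj : j = i
    · simp only [hj, dite_true, leaves_map]
      exact hs.1.map (fun _ _ e => inner_inj h i e)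
    · simp [hj, leaves]
  · by_cases h1 : j = i
    · have h2 : j' ≠ i := fun e => hj (h1.trans e.symm)
      simp only [h1, h2, dite_true, dite_false, leaves_map, leaves]
      intro a ha ha'
      rw [List.mem_singleton] at ha'
      obtain ⟨b, -, rfl⟩ := List.mem_map.1 ha
      exact outer_ne_inner h i h2 b ha'.symm
    · by_cases h2 : j' = i
      · simp only [h1, h2, dite_true, dite_false, leaves_map, leaves]
        intro a ha' ha
        rw [List.mem_singleton] at ha'
        obtain ⟨b, -, rfl⟩ := List.mem_map.1 ha
        exact outer_ne_inner h i h1 b ha'.symm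
      · simp only [h1, h2, dite_false, leaves]
        intro a ha ha'
        rw [List.mem_singleton] at ha ha'
        exact hj (outer_inj h i h1 h2 (ha.symm.trans ha'))
  · rcases position_cases h i a with ⟨l, rfl⟩ | ⟨j, hj, rfl⟩
    · exact ⟨i, by simpa [leaves_map] using ⟨l, hs.2 l, rfl⟩⟩
    · exact ⟨j, by simp [hj, leaves]⟩

end Tree

/-- Planar trees whose leaves are labelled bijectively by the `n` inputs. -/
def LTree (S : Sig.{v}) (n : ℕ) : Type v := {t : Tree S (Fin n) // t.IsLabelled}

instance LTree.setoid (S : Sig.{v}) (n : ℕ) : Setoid (LTree S n) where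
  r t s := Tree.Equivalent t.1 s.1
  iseqv := ⟨fun _ => .refl _, .symm, .trans⟩

/-- The tree monomials of arity `n`: labelled trees up to equivalence. -/
def Monomial (S : Sig.{v}) (n : ℕ) : Type v := Quotient (LTree.setoid S n)

namespace Monomial

variable {S : Sig.{v}}

def mk {n : ℕ} (t : Tree S (Fin n)) (ht : t.IsLabelled) : Monomial S n :=
  Quotient.mk _ ⟨t, ht⟩

/-- The right action of `Sₙ`: the leaf labelled `σ j` gets the label `j`. -/
def act {n : ℕ} (σ : Equiv.Perm (Fin n)) : Monomial S n → Monomial S n :=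
  Quotient.map (fun t => ⟨t.1.map σ.symm, t.2.map σ.symm⟩) (fun _ _ h => h.bind_left _)

def comp {m n p : ℕ} (h : p + 1 = m + n) (i : Fin m) :
    Monomial S m → Monomial S n → Monomial S p :=
  Quotient.map₂ (fun t s => ⟨t.1.graft h i s.1, t.2.graft h i s.2⟩) (by
    intro t t' ht s s' hs
    refine (ht.bind_left _).trans (Tree.Equivalent.bind_right _ (fun j => ?_))
    by_cases hj : j = i
    · simp only [hj, dite_true]
      exact hs.bind_left _
    · simp only [hj, dite_false]
      exact .refl _)

theorem isLabelled_leaf : (Tree.leaf 0 : Tree S (Fin 1)).IsLabelled :=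
  ⟨by simp [Tree.leaves], fun l => by simp [Tree.leaves, Subsingleton.elim l 0]⟩

theorem act_one {n : ℕ} (a : Monomial S n) : act 1 a = a := by
  induction a using Quotient.inductionOn with
  | h t => exact congrArg (Quotient.mk _) (Subtype.ext (Tree.bind_leaf t.1))

theorem act_mul {n : ℕ} (σ τ : Equiv.Perm (Fin n)) (a : Monomial S n) :
    act (σ * τ) a = act τ (act σ a) := by
  induction a using Quotient.inductionOn with
  | h t =>
    refine congrArg (Quotient.mk _) (Subtype.ext ?_)
    exact (Tree.map_map σ.symm τ.symm t.1).symm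

theorem comp_assoc {l m n p q r : ℕ} (h₁ : p + 1 = l + m) (h₂ : r + 1 = p + n)
    (h₃ : q + 1 = m + n) (h₄ : r + 1 = l + q) (i : Fin l) (j : Fin m)
    (a : Monomial S l) (b : Monomial S m) (c : Monomial S n) :
    comp h₂ (inner h₁ i j) (comp h₁ i a b) c = comp h₄ i a (comp h₃ j b c) := by
  induction a, b, c using Quotient.inductionOn₃ with
  | h t s r =>
    refine congrArg (Quotient.mk (LTree.setoid S _)) (Subtype.ext ?_)
    exact Tree.graft_assoc h₁ h₂ h₃ h₄ i j t.1 s.1 r.1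

theorem comp_comm {l m n p q r : ℕ} (h₁ : p + 1 = l + m) (h₂ : r + 1 = p + n)
    (h₃ : q + 1 = l + n) (h₄ : r + 1 = q + m) (i j : Fin l) (hij : i < j)
    (a : Monomial S l) (b : Monomial S m) (c : Monomial S n) :
    comp h₂ (outer h₁ i j hij.ne') (comp h₁ i a b) c
      = comp h₄ (outer h₃ j i hij.ne) (comp h₃ j a c) b := by
  induction a, b, c using Quotient.inductionOn₃ with
  | h t s r =>
    refine congrArg (Quotient.mk (LTree.setoid S _)) (Subtype.ext ?_)
    exact Tree.graft_comm h₁ h₂ h₃ h₄ i j hij t.1 s.1 r.1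

theorem one_comp {n : ℕ} (h : n + 1 = 1 + n) (a : Monomial S n) :
    comp h 0 (mk (Tree.leaf 0) isLabelled_leaf) a = a := by
  induction a using Quotient.inductionOn with
  | h t =>
    refine congrArg (Quotient.mk (LTree.setoid S _)) (Subtype.ext ?_)
    exact Tree.leaf_graft h t.1

theorem comp_one {m : ℕ} (h : m + 1 = m + 1) (i : Fin m) (a : Monomial S m) :
    comp h i a (mk (Tree.leaf 0) isLabelled_leaf) = a := by
  induction a using Quotient.inductionOn with
  | h t =>
    refine congrArg (Quotient.mk (LTree.setoid S _)) (Subtype.ext ?_)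
    exact Tree.graft_leaf h i t.1

theorem act_comp {m n p : ℕ} (h : p + 1 = m + n) (i : Fin m) (σ : Equiv.Perm (Fin m))
    (σ' : Equiv.Perm (Fin p))
    (h₁ : ∀ (j : Fin m) (hj : j ≠ i),
      σ' (outer h i j hj) = outer h (σ i) (σ j) (σ.injective.ne hj))
    (h₂ : ∀ l : Fin n, σ' (inner h i l) = inner h (σ i) l)
    (a : Monomial S m) (b : Monomial S n) :
    comp h i (act σ a) b = act σ' (comp h (σ i) a b) := by
  induction a, b using Quotient.inductionOn₂ with
  | h t s =>
    refine congrArg (Quotient.mk (LTree.setoid S _)) (Subtype.ext ?_)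
    exact Tree.map_graft h i σ σ' h₁ h₂ t.1 s.1

theorem comp_act {m n p : ℕ} (h : p + 1 = m + n) (i : Fin m) (τ : Equiv.Perm (Fin n))
    (τ' : Equiv.Perm (Fin p))
    (h₁ : ∀ (j : Fin m) (hj : j ≠ i), τ' (outer h i j hj) = outer h i j hj)
    (h₂ : ∀ l : Fin n, τ' (inner h i l) = inner h i (τ l))
    (a : Monomial S m) (b : Monomial S n) :
    comp h i a (act τ b) = act τ' (comp h i a b) := by
  induction a, b using Quotient.inductionOn₂ with
  | h t s =>
    refine congrArg (Quotient.mk (LTree.setoid S _)) (Subtype.ext ?_)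
    exact Tree.graft_map h i τ τ' h₁ h₂ t.1 s.1

/-- The bilinear extension of the partial composition of monomials. -/
def compLin (k : Type u) [CommRing k] {m n p : ℕ} (h : p + 1 = m + n) (i : Fin m) :
    (Monomial S m →₀ k) →ₗ[k] (Monomial S n →₀ k) →ₗ[k] (Monomial S p →₀ k) :=
  Finsupp.lift _ k _ (fun a => Finsupp.lmapDomain k k (comp h i a))

theorem compLin_single (k : Type u) [CommRing k] {m n p : ℕ} (h : p + 1 = m + n) (i : Fin m)
    (a : Monomial S m) (b : Monomial S n) (x y : k) :
    compLin k h i (Finsupp.single a x) (Finsupp.single b y)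
      = Finsupp.single (comp h i a b) (x * y) := by
  simp [compLin, Finsupp.mapDomain_single]

end Monomial

/-- The free operad generated by the `𝕊`-module with basis `S`: in arity `n` it has the tree
monomials as a basis. -/
def free (k : Type u) [CommRing k] (S : Sig.{v}) : Operad.{u, max u v} k where
  carrier n := Monomial S n →₀ k
  act σ := Finsupp.lmapDomain k k (Monomial.act σ)
  comp h i := Monomial.compLin k h i
  one := Finsupp.single (Monomial.mk (Tree.leaf 0) Monomial.isLabelled_leaf) 1
  act_one {n} μ := by
    induction μ using Finsupp.induction_linear with
    | zero => simp only [map_zero]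
    | add x y hx hy => simp only [map_add, hx, hy]
    | single b y =>
    simp only [Finsupp.lmapDomain_apply, Finsupp.mapDomain_single, Monomial.act_one]
  act_mul σ τ μ := by
    induction μ using Finsupp.induction_linear with
    | zero => simp only [map_zero]
    | add x y hx hy => simp only [map_add, hx, hy]
    | single b y =>
    simp only [Finsupp.lmapDomain_apply, Finsupp.mapDomain_single, Monomial.act_mul]
  comp_assoc h₁ h₂ h₃ h₄ i j η μ ν := by
    induction η using Finsupp.induction_linear with
    | zero => simp only [map_zero, LinearMap.zero_apply]
    | add x y hx hy => simp only [map_add, LinearMap.add_apply, hx, hy]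
    | single a x =>
    induction μ using Finsupp.induction_linear with
    | zero => simp only [map_zero, LinearMap.zero_apply]
    | add x y hx hy => simp only [map_add, LinearMap.add_apply, hx, hy]
    | single b y =>
    induction ν using Finsupp.induction_linear with
    | zero => simp only [map_zero]
    | add x y hx hy => simp only [map_add, hx, hy]
    | single c z =>
    simp only [Monomial.compLin_single, Monomial.comp_assoc h₁ h₂ h₃ h₄, mul_assoc]
  comp_comm h₁ h₂ h₃ h₄ i j hij η μ ν := by
    induction η using Finsupp.induction_linear with
    | zero => simp only [map_zero, LinearMap.zero_apply]
    | add x y hx hy => simp only [map_add, LinearMap.add_apply, hx, hy]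
    | single a x =>
    induction μ using Finsupp.induction_linear with
    | zero => simp only [map_zero, LinearMap.zero_apply]
    | add x y hx hy => simp only [map_add, LinearMap.add_apply, hx, hy]
    | single b y =>
    induction ν using Finsupp.induction_linear with
    | zero => simp only [map_zero, LinearMap.zero_apply]
    | add x y hx hy => simp only [map_add, LinearMap.add_apply, hx, hy]
    | single c z =>
    simp only [Monomial.compLin_single, Monomial.comp_comm h₁ h₂ h₃ h₄ i j hij, mul_assoc,
      mul_comm y z]
  one_comp h μ := by
    induction μ using Finsupp.induction_linear with
    | zero => simp only [map_zero]
    | add x y hx hy => simp only [map_add, hx, hy]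
    | single b y =>
    simp only [Monomial.compLin_single, Monomial.one_comp, one_mul]
  comp_one h i μ := by
    induction μ using Finsupp.induction_linear with
    | zero => simp only [map_zero, LinearMap.zero_apply]
    | add x y hx hy => simp only [map_add, LinearMap.add_apply, hx, hy]
    | single b y =>
    simp only [Monomial.compLin_single, Monomial.comp_one, mul_one]
  act_comp h i σ σ' h₁ h₂ μ ν := by
    induction μ using Finsupp.induction_linear with
    | zero => simp only [map_zero, LinearMap.zero_apply]
    | add x y hx hy => simp only [map_add, LinearMap.add_apply, hx, hy]
    | single b y =>
    induction ν using Finsupp.induction_linear with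
    | zero => simp only [map_zero]
    | add x y hx hy => simp only [map_add, hx, hy]
    | single c z =>
    simp only [Monomial.compLin_single, Finsupp.lmapDomain_apply, Finsupp.mapDomain_single,
      Monomial.act_comp h i σ σ' h₁ h₂]
  comp_act h i τ τ' h₁ h₂ μ ν := by
    induction μ using Finsupp.induction_linear with
    | zero => simp only [map_zero, LinearMap.zero_apply]
    | add x y hx hy => simp only [map_add, LinearMap.add_apply, hx, hy]
    | single b y =>
    induction ν using Finsupp.induction_linear with
    | zero => simp only [map_zero]
    | add x y hx hy => simp only [map_add, hx, hy]
    | single c z =>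
    simp only [Monomial.compLin_single, Finsupp.lmapDomain_apply, Finsupp.mapDomain_single,
      Monomial.comp_act h i τ τ' h₁ h₂]

instance {S : Sig.{v}} {n : ℕ} (t : Tree S (Fin n)) : Decidable t.IsLabelled :=
  inferInstanceAs (Decidable (_ ∧ _))

/-- The basis element of the free operad given by a labelled tree. -/
def mono (k : Type u) [CommRing k] {S : Sig.{v}} {n : ℕ} (t : Tree S (Fin n))
    (ht : t.IsLabelled := by decide) : (free k S).carrier n :=
  (Finsupp.single (Monomial.mk t ht) 1 : Monomial S n →₀ k)

/-- The binary generator `θ`, that is the operation `(x₀, x₁) ↦ θ(x₀, x₁)`. -/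
def gen (k : Type u) [CommRing k] {S : Sig.{v}} (θ : S.Bin) : (free k S).carrier 2 :=
  mono k (Tree.bin θ (Tree.leaf 0) (Tree.leaf 1))
    (by simp only [Tree.IsLabelled, Tree.leaves]; decide)

/-! ### Morphisms of free operads given on generators -/

/-- An assignment of tree monomials to generators that respects the action of `S₂`. -/
structure Subst (S : Sig.{v}) (T : Sig.{w}) where
  un : S.Un → Tree T (Fin 1)
  bin : S.Bin → Tree T (Fin 2)
  un_labelled : ∀ ω, (un ω).IsLabelled
  bin_labelled : ∀ θ, (bin θ).IsLabelled
  bin_swap : ∀ θ, Tree.Equivalent (bin (S.swap θ)) ((bin θ).map (Equiv.swap 0 1))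

namespace Subst

variable {S : Sig.{v}} {T : Sig.{w}} (f : Subst S T)

/-- Replacement of each vertex of a tree by the tree assigned to its generator. -/
def tree {L : Type} : Tree S L → Tree T L
  | .leaf l => .leaf l
  | .un ω t => (f.un ω).bind (fun _ => tree t)
  | .bin θ t s => (f.bin θ).bind ![tree t, tree s]

theorem tree_bind {L M : Type} (g : L → Tree S M) (t : Tree S L) :
    f.tree (t.bind g) = (f.tree t).bind (fun l => f.tree (g l)) := by
  induction t with
  | leaf l => rfl
  | un ω t ih => simp [Tree.bind, tree, ih, Tree.bind_bind]
  | bin θ t s iht ihs =>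
    simp only [Tree.bind, tree, iht, ihs, Tree.bind_bind]
    congr 1
    funext a
    fin_cases a <;> rfl

theorem tree_map {L M : Type} (g : L → M) (t : Tree S L) :
    f.tree (t.map g) = (f.tree t).map g := by
  unfold Tree.map
  rw [tree_bind]
  rfl

theorem tree_graft {m n p : ℕ} (h : p + 1 = m + n) (i : Fin m) (t : Tree S (Fin m))
    (s : Tree S (Fin n)) : f.tree (t.graft h i s) = (f.tree t).graft h i (f.tree s) := by
  unfold Tree.graft
  rw [tree_bind]
  congr 1
  funext j
  by_cases hj : j = i
  · simp only [hj, dite_true, tree_map]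
  · simp only [hj, dite_false, tree]

theorem perm_leaves {L : Type} (t : Tree S L) : (f.tree t).leaves.Perm t.leaves := by
  induction t with
  | leaf l => exact .refl _
  | un ω t ih =>
    have h : (f.un ω).leaves.Perm [0] :=
      (List.perm_ext_iff_of_nodup (f.un_labelled ω).1 (by simp)).2
        (fun a => by
          have h1 := (f.un_labelled ω).2 a
          fin_cases a
          simpa using h1)
    simp only [tree, Tree.leaves_bind, Tree.leaves]
    refine (h.flatMap_right _).trans ?_
    simpa using ih
  | bin θ t s iht ihs =>
    have h : (f.bin θ).leaves.Perm [0, 1] :=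
      (List.perm_ext_iff_of_nodup (f.bin_labelled θ).1 (by simp)).2
        (fun a => by
          have h1 := (f.bin_labelled θ).2 a
          fin_cases a <;> simpa using h1)
    simp only [tree, Tree.leaves_bind, Tree.leaves]
    refine (h.flatMap_right _).trans ?_
    simpa using iht.append ihs

theorem isLabelled {n : ℕ} {t : Tree S (Fin n)} (ht : t.IsLabelled) : (f.tree t).IsLabelled :=
  ⟨(f.perm_leaves t).nodup_iff.2 ht.1, fun l => (f.perm_leaves t).mem_iff.2 (ht.2 l)⟩

theorem equivalent {L : Type} {t s : Tree S L} (h : t.Equivalent s) :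
    (f.tree t).Equivalent (f.tree s) := by
  induction h with
  | refl t => exact .refl _
  | symm _ ih => exact .symm ih
  | trans _ _ ih₁ ih₂ => exact .trans ih₁ ih₂
  | un ω _ ih => exact .bind_right _ (fun _ => ih)
  | bin θ _ _ ih₁ ih₂ =>
    refine .bind_right _ (fun a => ?_)
    fin_cases a
    · exact ih₁
    · exact ih₂
  | swap θ t s =>
    have h := (f.bin_swap θ).bind_left ![f.tree s, f.tree t]
    rw [Tree.map_bind] at h
    refine Tree.Equivalent.symm (h.trans ?_)
    refine .bind_right _ (fun a => ?_)
    fin_cases a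
    · exact .refl _
    · exact .refl _

def monomial {n : ℕ} : Monomial S n → Monomial T n :=
  Quotient.map (fun t => ⟨f.tree t.1, f.isLabelled t.2⟩) (fun _ _ h => f.equivalent h)

/-- The morphism of free operads with the given values on the generators. -/
def hom (k : Type u) [CommRing k] : Hom (free k S) (free k T) where
  toFun n := Finsupp.lmapDomain k k (f.monomial (n := n))
  map_one := Finsupp.mapDomain_single
  map_act σ μ := by
    have e : ∀ a, f.monomial (Monomial.act σ a) = Monomial.act σ (f.monomial a) := by
      intro a
      induction a using Quotient.inductionOn with
      | h t =>
        refine congrArg (Quotient.mk (LTree.setoid T _)) (Subtype.ext ?_)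
        exact f.tree_map _ t.1
    change Monomial S _ →₀ k at μ
    change Finsupp.lmapDomain k k f.monomial (Finsupp.lmapDomain k k (Monomial.act σ) μ)
      = Finsupp.lmapDomain k k (Monomial.act σ) (Finsupp.lmapDomain k k f.monomial μ)
    induction μ using Finsupp.induction_linear with
    | zero => simp only [map_zero]
    | add x y hx hy => simp only [map_add, hx, hy]
    | single b y =>
    simp only [Finsupp.lmapDomain_apply, Finsupp.mapDomain_single, e]
  map_comp h i μ ν := by
    have e : ∀ a b, f.monomial (Monomial.comp h i a b)
        = Monomial.comp h i (f.monomial a) (f.monomial b) := by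
      intro a b
      induction a, b using Quotient.inductionOn₂ with
      | h t s =>
        refine congrArg (Quotient.mk (LTree.setoid T _)) (Subtype.ext ?_)
        exact f.tree_graft h i t.1 s.1
    change Monomial S _ →₀ k at μ ν
    change Finsupp.lmapDomain k k f.monomial (Monomial.compLin k h i μ ν)
      = Monomial.compLin k h i (Finsupp.lmapDomain k k f.monomial μ)
        (Finsupp.lmapDomain k k f.monomial ν)
    induction μ using Finsupp.induction_linear with
    | zero => simp only [map_zero, LinearMap.zero_apply]
    | add x y hx hy => simp only [map_add, LinearMap.add_apply, hx, hy]
    | single a x =>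
    induction ν using Finsupp.induction_linear with
    | zero => simp only [map_zero]
    | add x y hx hy => simp only [map_add, hx, hy]
    | single b y =>
    simp only [Monomial.compLin_single, Finsupp.lmapDomain_apply, Finsupp.mapDomain_single, e]

end Subst

/-! ### Presented unary-binary operads and their pre-induced operads -/

/-- A presentation of a unary-binary operad: bases `Un` and `Bin` of the spaces `W₁` and `W₂` of
generators, and a set of relators in the free operad. -/
structure Presentation (k : Type u) [CommRing k] where
  sig : Sig.{v}
  rel : Set (Σ n : ℕ, (free k sig).carrier n)

/-- The presented operad, the quotient of the free operad by the ideal of the relators. -/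
def Presentation.operad {k : Type u} [CommRing k] (Q : Presentation.{u, v} k) :
    Operad.{u, max u v} k :=
  (free k Q.sig).quot (OpIdeal.span _ Q.rel)

/-- The binary generators `≺_{ω,θ}` and `≻_{ω,θ}`. -/
inductive PreGen (S : Sig.{v}) : Type v where
  | prec : S.Un → S.Bin → PreGen S
  | succ : S.Un → S.Bin → PreGen S

/-- The generators of the pre-induced operad, with `≺_{ω,θ} ^ (12) = ≻_{ω,θ'}` and
`≻_{ω,θ} ^ (12) = ≺_{ω,θ'}`, where `θ' = θ ^ (12)`. -/
def preSig (S : Sig.{v}) : Sig.{v} where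
  Un := PEmpty
  Bin := PreGen S
  swap
    | .prec ω θ => .succ ω (S.swap θ)
    | .succ ω θ => .prec ω (S.swap θ)
  swap_swap g := by cases g <;> simp [S.swap_swap]

/-- The assignment `≺_{ω,θ} ↦ θ(id ⊗ ω)`, `≻_{ω,θ} ↦ θ(ω ⊗ id)`. -/
def preSubst (S : Sig.{v}) : Subst (preSig S) S where
  un ω := nomatch ω
  bin
    | .prec ω θ => .bin θ (.leaf 0) (.un ω (.leaf 1))
    | .succ ω θ => .bin θ (.un ω (.leaf 0)) (.leaf 1)
  un_labelled ω := nomatch ω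
  bin_labelled θ := by
    cases θ <;> simp only [Tree.IsLabelled, Tree.leaves] <;> decide
  bin_swap θ := by
    cases θ with
    | prec ω θ => exact .symm (.swap θ _ _)
    | succ ω θ => exact .symm (.swap θ _ _)

section

variable {k : Type u} [CommRing k] (Q : Presentation.{u, v} k)

/-- The pre-induced homomorphism from the free operad on the `≺_{ω,θ}`, `≻_{ω,θ}` to the
presented operad. -/
def preHom : Hom (free k (preSig Q.sig)) Q.operad :=
  ((preSubst Q.sig).hom k).trans (Operad.mkQ _ _)

/-- The binary quadratic relators of the pre-induced operad: the elements of arity three in the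
kernel of the pre-induced homomorphism. -/
def preRel : Submodule k ((free k (preSig Q.sig)).carrier 3) :=
  LinearMap.ker ((preHom Q).toFun 3)

/-- The presentation of the pre-induced operad. -/
def prePresentation : Presentation.{u, v} k where
  sig := preSig Q.sig
  rel := Sigma.mk 3 '' (preRel Q : Set _)

end

/-! ### Commutative differential algebras and Novikov algebras -/

/-- One unary generator `D` and one commutative binary generator. -/
def diffSig : Sig.{0} where
  Un := Unit
  Bin := Unit
  swap := id
  swap_swap _ := rfl

/-- The product `x y`. -/
abbrev mulT {L : Type} (x y : Tree diffSig L) : Tree diffSig L := Tree.bin (S := diffSig) () x y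

/-- The derivative `D(x)`. -/
abbrev derT {L : Type} (x : Tree diffSig L) : Tree diffSig L := Tree.un (S := diffSig) () x

/-- The relators `(x y) z - x (y z)`, `x y - y x` and `D(x y) - x D(y) - D(x) y` of
commutative differential algebras. The second one is zero, since the binary generator is
already symmetric. -/
def diffRel (k : Type u) [CommRing k] : Set (Σ n : ℕ, (free k diffSig).carrier n) :=
  {⟨3, mono k (mulT (mulT (.leaf 0) (.leaf 1)) (.leaf 2))
      - mono k (mulT (.leaf 0) (mulT (.leaf 1) (.leaf 2)))⟩,
   ⟨2, mono k (mulT (.leaf 0) (.leaf 1)) - mono k (mulT (.leaf 1) (.leaf 0))⟩,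
   ⟨2, mono k (derT (mulT (.leaf 0) (.leaf 1)))
      - mono k (mulT (.leaf 0) (derT (.leaf 1)))
      - mono k (mulT (derT (.leaf 0)) (.leaf 1))⟩}

/-- The presentation of the operad of commutative differential algebras. -/
def diffPresentation (k : Type u) [CommRing k] : Presentation.{u, 0} k where
  sig := diffSig
  rel := diffRel k

/-- The binary generators `▷` and `▷' = ▷ ^ (12)` of the operad of Novikov algebras. -/
inductive NovGen : Type where
  | op : NovGen
  | opp : NovGen

def novSig : Sig.{0} where
  Un := PEmpty
  Bin := NovGen
  swap
    | .op => .opp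
    | .opp => .op
  swap_swap g := by cases g <;> rfl

/-- The product `x ▷ y`. -/
abbrev novT {L : Type} (x y : Tree novSig L) : Tree novSig L :=
  Tree.bin (S := novSig) NovGen.op x y

section

variable (k : Type u) [CommRing k]

/-- The relator `(x ▷ y) ▷ z - x ▷ (y ▷ z) - ((y ▷ x) ▷ z - y ▷ (x ▷ z))`, where
`x, y, z` are the inputs `0, 1, 2`. -/
def preLieRelator : (free k novSig).carrier 3 :=
  mono k (novT (novT (.leaf 0) (.leaf 1)) (.leaf 2))
    - mono k (novT (.leaf 0) (novT (.leaf 1) (.leaf 2)))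
    - (mono k (novT (novT (.leaf 1) (.leaf 0)) (.leaf 2))
      - mono k (novT (.leaf 1) (novT (.leaf 0) (.leaf 2))))

/-- The relator `(x ▷ y) ▷ z - (x ▷ z) ▷ y`. -/
def rightCommRelator : (free k novSig).carrier 3 :=
  mono k (novT (novT (.leaf 0) (.leaf 1)) (.leaf 2))
    - mono k (novT (novT (.leaf 0) (.leaf 2)) (.leaf 1))

/-- The `k S₃`-submodule generated by the two Novikov relators. -/
def novRel : Submodule k ((free k novSig).carrier 3) :=
  Submodule.span k {r | ∃ σ : Equiv.Perm (Fin 3),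
    r = (free k novSig).act σ (preLieRelator k) ∨ r = (free k novSig).act σ (rightCommRelator k)}

/-- The presentation of the operad of Novikov algebras. -/
def novPresentation : Presentation.{u, 0} k where
  sig := novSig
  rel := Sigma.mk 3 '' (novRel k : Set _)

/-- The class in a presented operad of a binary generator. -/
def Presentation.gen {k : Type u} [CommRing k] (Q : Presentation.{u, v} k) (θ : Q.sig.Bin) :
    Q.operad.carrier 2 :=
  (Operad.mkQ _ _).toFun 2 (InducedOperad.gen k θ)

end

/-- The renaming `▷ ↦ ≺`, `▷' ↦ ≻` of generators. -/
def novSubst : Subst novSig (preSig diffSig) where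
  un ω := nomatch ω
  bin
    | .op => .bin (.prec () ()) (.leaf 0) (.leaf 1)
    | .opp => .bin (.succ () ()) (.leaf 0) (.leaf 1)
  un_labelled ω := nomatch ω
  bin_labelled θ := by
    cases θ <;> simp only [Tree.IsLabelled, Tree.leaves] <;> decide
  bin_swap θ := by
    cases θ with
    | op => exact .symm (.swap (S := preSig diffSig) (.prec () ()) _ _)
    | opp => exact .symm (.swap (S := preSig diffSig) (.succ () ()) _ _)

/-! ### Evaluation in algebras -/

/-- Linear and bilinear operations on a `k`-module `A` for the generators in `S`, compatible with
the action of `S₂`. -/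
structure SigAlg (k : Type u) [CommRing k] (S : Sig.{v}) (A : Type w) [AddCommGroup A]
    [Module k A] where
  un : S.Un → A →ₗ[k] A
  bin : S.Bin → A →ₗ[k] A →ₗ[k] A
  bin_swap : ∀ θ a b, bin (S.swap θ) a b = bin θ b a

namespace SigAlg

variable {k : Type u} [CommRing k] {S : Sig.{v}} {A : Type w} [AddCommGroup A] [Module k A]
  (α : SigAlg k S A)

def evalTree {L : Type} (x : L → A) : Tree S L → A
  | .leaf l => x l
  | .un ω t => α.un ω (evalTree x t)
  | .bin θ t s => α.bin θ (evalTree x t) (evalTree x s)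

theorem evalTree_eq {L : Type} (x : L → A) {t s : Tree S L} (h : t.Equivalent s) :
    α.evalTree x t = α.evalTree x s := by
  induction h with
  | refl t => rfl
  | symm _ ih => exact ih.symm
  | trans _ _ ih₁ ih₂ => exact ih₁.trans ih₂
  | un ω _ ih => simp only [evalTree, ih]
  | bin θ _ _ ih₁ ih₂ => simp only [evalTree, ih₁, ih₂]
  | swap θ t s => simp only [evalTree, α.bin_swap]

/-- The value of an element of the free operad at elements `x 0, …, x (n - 1)` of `A`. -/
def eval {n : ℕ} (r : (free k S).carrier n) (x : Fin n → A) : A :=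
  Finsupp.sum (r : Monomial S n →₀ k) (fun a c =>
    c • Quotient.lift (fun t : LTree S n => α.evalTree x t.1) (fun _ _ h => α.evalTree_eq x h) a)

end SigAlg

/-- The product `a ▷ b = a D(b)` on a commutative associative algebra with a linear map `D`. -/
def gelfand {k : Type u} [CommRing k] {A : Type w} [NonUnitalCommRing A] [Module k A]
    [IsScalarTower k A A] [SMulCommClass k A A] (D : A →ₗ[k] A) : SigAlg k novSig A where
  un ω := nomatch ω
  bin
    | .op => (LinearMap.mul k A).compl₂ D
    | .opp => ((LinearMap.mul k A).compl₂ D).flip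
  bin_swap θ a b := by cases θ <;> rfl

end InducedOperad

end

noncomputable section

namespace InducedOperad

section

variable {k : Type u} [CommRing k]

/-! ### Operadic ideals and quotient operads -/

/-! Write $x'$ for $D(x)$. The proof is a cycle of three inclusions between subspaces of arity
three: Novikov consequences lie in $\ker\Phi$, elements of $\ker\Phi$ are identities of $a\,D(b)$ on
every commutative differential algebra, and an identity of the differential polynomials in three
variables is a Novikov consequence.

The first inclusion (`novRel_le_comap`) is a calculation in the ideal of $\mathcal D$. Right
commutativity holds because $(xy')z'$ is congruent to $x(y'z')$, which is symmetric in $y,z$. The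
pre-Lie relation holds because the associator $(xy')z'-x(yz')'$ is congruent to $-(xy)z''$, which is
symmetric in $x,y$.

The second (`gelfand_eval_eq_zero`) is soundness: the identities of an algebra form an operadic
ideal (`SigAlg.identities`), so they contain the ideal generated by the relators as soon as they
contain the relators.

The third (`mem_novRel_of_eval_eq_zero`) is a normal form argument. At the variables, $(a\rhd b)\rhd
c$ takes the value $ab'c'$, and $a\rhd(b\rhd c)$ takes the value $ab'c'+abc''$. Hence $ab'c'$ lifts
to $(a\rhd b)\rhd c$, and $abc''$ lifts to $a\rhd(b\rhd c)-(a\rhd b)\rhd c$. The only ambiguities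
are the exchange of $b,c$ in the first lift and of $a,b$ in the second; they are exactly the two
Novikov relators. So lifting is a left inverse of evaluation modulo `novRel`
(`liftPoly_evalLin_sub_mem`), and an element with value zero lies in `novRel`. All coefficients are
integers and nothing is divided, so the characteristic plays no role.

The isomorphism of operads follows because the renaming of generators is invertible and matches the
two spaces of relators. -/

theorem OpIdeal.subset_span {P : Operad.{u, v} k} {S : Set (Σ n : ℕ, P.carrier n)} {n : ℕ}
    {μ : P.carrier n} (h : ⟨n, μ⟩ ∈ S) : μ ∈ (OpIdeal.span P S).sub n :=
  (Submodule.mem_iInf _).2 fun I => I.2 _ h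

theorem OpIdeal.span_le {P : Operad.{u, v} k} {S : Set (Σ n : ℕ, P.carrier n)} (I : OpIdeal P)
    (h : ∀ s ∈ S, s.2 ∈ I.sub s.1) (n : ℕ) : (OpIdeal.span P S).sub n ≤ I.sub n :=
  iInf_le (fun I : {I : OpIdeal P // ∀ s ∈ S, s.2 ∈ I.sub s.1} => I.1.sub n) ⟨I, h⟩

/-- The preimage of an operadic ideal under a morphism. -/
def OpIdeal.comap {P : Operad.{u, v} k} {Q : Operad.{u, w} k} (f : Hom P Q) (I : OpIdeal Q) :
    OpIdeal P where
  sub n := (I.sub n).comap (f.toFun n)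
  act_mem σ μ hμ := by
    rw [Submodule.mem_comap, f.map_act]
    exact I.act_mem σ _ hμ
  comp_mem_left h i μ ν hμ := by
    rw [Submodule.mem_comap, f.map_comp]
    exact I.comp_mem_left h i _ _ hμ
  comp_mem_right h i μ ν hν := by
    rw [Submodule.mem_comap, f.map_comp]
    exact I.comp_mem_right h i _ _ hν

/-- The morphism of quotient operads induced by a morphism that maps one ideal to another. -/
def Hom.quotMap {P : Operad.{u, v} k} {Q : Operad.{u, w} k} (f : Hom P Q) (I : OpIdeal P)
    (J : OpIdeal Q) (h : ∀ n, I.sub n ≤ (J.sub n).comap (f.toFun n)) :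
    Hom (P.quot I) (Q.quot J) where
  toFun n := (I.sub n).mapQ (J.sub n) (f.toFun n) (h n)
  map_one := congrArg Submodule.Quotient.mk f.map_one
  map_act σ μ := by
    obtain ⟨μ, rfl⟩ := Submodule.Quotient.mk_surjective _ μ
    exact congrArg Submodule.Quotient.mk (f.map_act σ μ)
  map_comp i hi μ ν := by
    obtain ⟨μ, rfl⟩ := Submodule.Quotient.mk_surjective _ μ
    obtain ⟨ν, rfl⟩ := Submodule.Quotient.mk_surjective _ ν
    exact congrArg Submodule.Quotient.mk (f.map_comp i hi μ ν)

theorem Hom.quotMap_isIso {P : Operad.{u, v} k} {Q : Operad.{u, w} k} (f : Hom P Q) (g : Hom Q P)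
    (I : OpIdeal P) (J : OpIdeal Q) (h : ∀ n, I.sub n ≤ (J.sub n).comap (f.toFun n))
    (h' : ∀ n, J.sub n ≤ (I.sub n).comap (g.toFun n))
    (hgf : ∀ n μ, g.toFun n (f.toFun n μ) = μ) (hfg : ∀ n μ, f.toFun n (g.toFun n μ) = μ) :
    (f.quotMap I J h).IsIso := by
  refine fun n => Function.bijective_iff_has_inverse.2 ⟨(g.quotMap J I h').toFun n, ?_, ?_⟩
  · intro μ
    obtain ⟨μ, rfl⟩ := Submodule.Quotient.mk_surjective _ μ
    exact congrArg Submodule.Quotient.mk (hgf n μ)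
  · intro μ
    obtain ⟨μ, rfl⟩ := Submodule.Quotient.mk_surjective _ μ
    exact congrArg Submodule.Quotient.mk (hfg n μ)

/-! ### Tree monomials in the free operad -/

variable {S : Sig.{v}} {T : Sig.{w}}

@[elab_as_elim]
-- Linear statements about the free operad need checking only on labelled trees; the quotient by
-- equivalence is hidden here.
theorem free_induction {n : ℕ} {p : (free k S).carrier n → Prop} (r : (free k S).carrier n)
    (zero : p 0) (add : ∀ r s, p r → p s → p (r + s))
    (smul_mono : ∀ (c : k) (t : Tree S (Fin n)) (ht : t.IsLabelled), p (c • mono k t ht)) :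
    p r := by
  change Monomial S n →₀ k at r
  induction r using Finsupp.induction_linear with
  | zero => exact zero
  | add x y hx hy => exact add x y hx hy
  | single a c =>
    induction a using Quotient.inductionOn with
    | h t =>
      have := smul_mono c t.1 t.2
      have e : c • mono k t.1 t.2 = (Finsupp.single (Monomial.mk t.1 t.2) c : Monomial S n →₀ k) :=
        (Finsupp.smul_single_one _ _)
      rw [e] at this
      exact this

theorem mono_congr {n : ℕ} {t s : Tree S (Fin n)} (ht : t.IsLabelled) (hs : s.IsLabelled)
    (h : t.Equivalent s) : mono k t ht = mono k s hs :=
  congrArg (fun a => (Finsupp.single a 1 : Monomial S n →₀ k)) (Quotient.sound h)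

theorem act_mono {n : ℕ} (σ : Equiv.Perm (Fin n)) (t : Tree S (Fin n)) (ht : t.IsLabelled) :
    (free k S).act σ (mono k t ht) = mono k (t.map σ.symm) (ht.map σ.symm) :=
  Finsupp.mapDomain_single

theorem comp_mono {m n p : ℕ} (h : p + 1 = m + n) (i : Fin m) (t : Tree S (Fin m))
    (ht : t.IsLabelled) (s : Tree S (Fin n)) (hs : s.IsLabelled) :
    (free k S).comp h i (mono k t ht) (mono k s hs)
      = mono k (t.graft h i s) (Tree.IsLabelled.graft h i ht hs) := by
  refine (Monomial.compLin_single k h i _ _ 1 1).trans ?_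
  rw [one_mul]
  rfl

theorem Subst.hom_mono (f : Subst S T) {n : ℕ} (t : Tree S (Fin n)) (ht : t.IsLabelled) :
    (f.hom k).toFun n (mono k t ht) = mono k (f.tree t) (f.isLabelled ht) :=
  Finsupp.mapDomain_single

theorem Subst.hom_hom (f : Subst S T) (g : Subst T S)
    (h : ∀ (n : ℕ) (t : Tree S (Fin n)), g.tree (f.tree t) = t) (n : ℕ)
    (r : (free k S).carrier n) : (g.hom k).toFun n ((f.hom k).toFun n r) = r := by
  induction r using free_induction with
  | zero => simp only [map_zero]
  | add r s hr hs => simp only [map_add, hr, hs]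
  | smul_mono c t ht => simp only [map_smul, Subst.hom_mono, h]

/-! ### Identities of an algebra -/

namespace SigAlg

variable {A : Type w} [AddCommGroup A] [Module k A] (α : SigAlg k S A)

/-- The evaluation of elements of the free operad as a linear map. -/
def evalLin {n : ℕ} (x : Fin n → A) : (free k S).carrier n →ₗ[k] A :=
  Finsupp.linearCombination k
    (Quotient.lift (fun t : LTree S n => α.evalTree x t.1) (fun _ _ h => α.evalTree_eq x h))

theorem eval_eq {n : ℕ} (r : (free k S).carrier n) (x : Fin n → A) :
    α.eval r x = α.evalLin x r :=
  rfl

theorem evalLin_mono {n : ℕ} (x : Fin n → A) (t : Tree S (Fin n)) (ht : t.IsLabelled) :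
    α.evalLin x (mono k t ht) = α.evalTree x t := by
  refine (Finsupp.linearCombination_single k _ _).trans ?_
  rw [one_smul]
  rfl

theorem evalTree_bind {L M : Type} (x : M → A) (f : L → Tree S M) (t : Tree S L) :
    α.evalTree x (t.bind f) = α.evalTree (fun l => α.evalTree x (f l)) t := by
  induction t with
  | leaf l => rfl
  | un ω t ih => simp only [Tree.bind, evalTree, ih]
  | bin θ t s iht ihs => simp only [Tree.bind, evalTree, iht, ihs]

theorem evalTree_congr {L : Type} {x y : L → A} (t : Tree S L) (h : ∀ l ∈ t.leaves, x l = y l) :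
    α.evalTree x t = α.evalTree y t := by
  induction t with
  | leaf l => exact h l (by simp [Tree.leaves])
  | un ω t ih => simp only [evalTree, ih h]
  | bin θ t s iht ihs =>
    simp only [Tree.leaves, List.mem_append] at h
    simp only [evalTree, iht fun l hl => h l (.inl hl), ihs fun l hl => h l (.inr hl)]

/-- The value of a tree is linear in an input that decorates exactly one leaf. -/
theorem exists_linear_evalTree {L : Type} [DecidableEq L] (x : L → A) (i : L) (t : Tree S L)
    (ht : t.leaves.Nodup) (hi : i ∈ t.leaves) :
    ∃ f : A →ₗ[k] A, ∀ a, α.evalTree (Function.update x i a) t = f a := by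
  -- At a binary vertex the input occurs in exactly one branch, so the other branch acts as a
  -- constant.
  have const : ∀ s : Tree S L, i ∉ s.leaves → ∀ a,
      α.evalTree (Function.update x i a) s = α.evalTree x s := fun s hs a =>
    α.evalTree_congr s fun l hl => Function.update_of_ne (by rintro rfl; exact hs hl) _ _
  induction t with
  | leaf l =>
    obtain rfl : i = l := by simpa [Tree.leaves] using hi
    exact ⟨LinearMap.id, fun a => by simp [evalTree]⟩
  | un ω t ih =>
    obtain ⟨f, hf⟩ := ih ht hi
    exact ⟨(α.un ω).comp f, fun a => by simp [evalTree, hf]⟩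
  | bin θ t s iht ihs =>
    obtain ⟨h₁, h₂, h₃⟩ := List.nodup_append'.1 ht
    rcases List.mem_append.1 hi with h | h
    · obtain ⟨f, hf⟩ := iht h₁ h
      exact ⟨((α.bin θ).flip (α.evalTree x s)).comp f, fun a => by
        simp [evalTree, hf, const s (fun h' => h₃ h h')]⟩
    · obtain ⟨f, hf⟩ := ihs h₂ h
      exact ⟨(α.bin θ (α.evalTree x t)).comp f, fun a => by
        simp [evalTree, hf, const t (fun h' => h₃ h' h)]⟩

theorem evalLin_act {n : ℕ} (σ : Equiv.Perm (Fin n)) (r : (free k S).carrier n) (x : Fin n → A) :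
    α.evalLin x ((free k S).act σ r) = α.evalLin (fun j => x (σ.symm j)) r := by
  induction r using free_induction with
  | zero => simp only [map_zero]
  | add r s hr hs => simp only [map_add, hr, hs]
  | smul_mono c t ht =>
    simp only [map_smul, act_mono, evalLin_mono, Tree.map, evalTree_bind, evalTree]

/-- The value `0` at the input `i` is a placeholder that `Function.update` overwrites with the value
of the grafted tree. -/
theorem evalTree_graft {m n p : ℕ} (h : p + 1 = m + n) (i : Fin m) (t : Tree S (Fin m))
    (s : Tree S (Fin n)) (x : Fin p → A) :
    α.evalTree x (t.graft h i s) = α.evalTree (Function.update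
      (fun j => if hj : j = i then 0 else x (outer h i j hj)) i
      (α.evalTree (fun l => x (inner h i l)) s)) t := by
  rw [Tree.graft, evalTree_bind]
  congr 1
  funext j
  by_cases hj : j = i
  · subst hj
    simp [Tree.map, evalTree_bind, evalTree]
  · simp [hj, evalTree]

/-- Both sides are linear in `μ`, which reduces `μ` to a tree. Linearity in `ν` then needs that the
label `i` occurs only once in that tree. -/
theorem evalLin_comp {m n p : ℕ} (h : p + 1 = m + n) (i : Fin m) (μ : (free k S).carrier m)
    (ν : (free k S).carrier n) (x : Fin p → A) :
    α.evalLin x ((free k S).comp h i μ ν) = α.evalLin (Function.update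
      (fun j => if hj : j = i then 0 else x (outer h i j hj)) i
      (α.evalLin (fun l => x (inner h i l)) ν)) μ := by
  induction μ using free_induction with
  | zero => simp only [map_zero, LinearMap.zero_apply]
  | add r s hr hs => simp only [map_add, LinearMap.add_apply, hr, hs]
  | smul_mono c t ht =>
    simp only [map_smul, LinearMap.smul_apply, evalLin_mono]
    congr 1
    obtain ⟨f, hf⟩ := α.exists_linear_evalTree
      (fun j => if hj : j = i then 0 else x (outer h i j hj)) i t ht.1 (ht.2 i)
    rw [hf]
    induction ν using free_induction with
    | zero => simp only [map_zero]
    | add r s hr hs => simp only [map_add, hr, hs]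
    | smul_mono c s hs =>
      simp only [map_smul, comp_mono, evalLin_mono, evalTree_graft, hf]

/-- The operadic ideal of the identities of an algebra. -/
def identities : OpIdeal (free k S) where
  sub n := ⨅ x : Fin n → A, LinearMap.ker (α.evalLin x)
  act_mem σ μ hμ := by
    simp only [Submodule.mem_iInf, LinearMap.mem_ker] at hμ ⊢
    intro x
    rw [evalLin_act, hμ]
  comp_mem_left h i μ ν hμ := by
    simp only [Submodule.mem_iInf, LinearMap.mem_ker] at hμ ⊢
    intro x
    rw [evalLin_comp, hμ]
  comp_mem_right h i μ ν hν := by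
    simp only [Submodule.mem_iInf, LinearMap.mem_ker] at hν ⊢
    intro x
    -- The input `i` of `μ` now receives zero, and each tree of `μ` is linear in that input.
    rw [evalLin_comp, hν]
    induction μ using free_induction with
    | zero => simp only [map_zero]
    | add r s hr hs => simp only [map_add, hr, hs, add_zero]
    | smul_mono c t ht =>
      obtain ⟨f, hf⟩ := α.exists_linear_evalTree
        (fun j => if hj : j = i then 0 else x (outer h i j hj)) i t ht.1 (ht.2 i)
      simp only [map_smul, evalLin_mono, hf, map_zero, smul_zero]

theorem mem_identities {n : ℕ} (r : (free k S).carrier n) :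
    r ∈ α.identities.sub n ↔ ∀ x : Fin n → A, α.eval r x = 0 := by
  simp only [identities, Submodule.mem_iInf, LinearMap.mem_ker, eval_eq]

end SigAlg

end

/-! ### The renaming of generators is invertible -/

/-- The renaming `≺ ↦ ▷`, `≻ ↦ ▷'` of generators. -/
def novSubstInv : Subst (preSig diffSig) novSig where
  un ω := nomatch ω
  bin
    | .prec _ _ => .bin (S := novSig) .op (.leaf 0) (.leaf 1)
    | .succ _ _ => .bin (S := novSig) .opp (.leaf 0) (.leaf 1)
  un_labelled ω := nomatch ω
  bin_labelled θ := by
    cases θ <;> simp only [Tree.IsLabelled, Tree.leaves] <;> decide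
  bin_swap θ := by
    cases θ with
    | prec => exact .symm (.swap (S := novSig) NovGen.op _ _)
    | succ => exact .symm (.swap (S := novSig) NovGen.opp _ _)

theorem novSubstInv_tree_novSubst_tree {L : Type} (t : Tree novSig L) :
    novSubstInv.tree (novSubst.tree t) = t := by
  induction t with
  | leaf l => rfl
  | un ω t ih => exact nomatch ω
  | bin θ t s iht ihs =>
    cases θ with
    | op => exact congrArg₂ (Tree.bin (S := novSig) NovGen.op) iht ihs
    | opp => exact congrArg₂ (Tree.bin (S := novSig) NovGen.opp) iht ihs

theorem novSubst_tree_novSubstInv_tree {L : Type} (t : Tree (preSig diffSig) L) :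
    novSubst.tree (novSubstInv.tree t) = t := by
  induction t with
  | leaf l => rfl
  | un ω t ih => exact nomatch ω
  | bin θ t s iht ihs =>
    cases θ with
    | prec => exact congrArg₂ (Tree.bin (S := preSig diffSig) (.prec () ())) iht ihs
    | succ => exact congrArg₂ (Tree.bin (S := preSig diffSig) (.succ () ())) iht ihs

/-! ### Commutative differential algebras -/

section

variable {k : Type u} [CommRing k]

section

variable {A : Type w} [NonUnitalCommRing A] [Module k A] [IsScalarTower k A A]
  [SMulCommClass k A A]

/-- The product and the map `D` of a commutative algebra with a linear map `D`. -/
def diffAlg (D : A →ₗ[k] A) : SigAlg k diffSig A where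
  un _ := D
  bin _ := LinearMap.mul k A
  bin_swap _ a b := mul_comm a b

/-- This links the abstract substitution defining `preHom` with the concrete product $a\,D(b)$.
Commutativity of the algebra is needed only for the opposite generator. -/
theorem diffAlg_evalTree (D : A →ₗ[k] A) {L : Type} (x : L → A) (t : Tree novSig L) :
    (diffAlg D).evalTree x ((preSubst diffSig).tree (novSubst.tree t))
      = (gelfand D).evalTree x t := by
  induction t with
  | leaf l => rfl
  | un ω t ih => exact nomatch ω
  | bin θ t s iht ihs =>
    cases θ with
    | op =>
      refine Eq.trans ?_ (congrArg₂ (fun a b => a * D b) iht ihs)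
      rfl
    | opp =>
      refine Eq.trans ?_ ((congrArg₂ (fun a b => D a * b) iht ihs).trans (mul_comm _ _))
      rfl

theorem diffAlg_evalLin (D : A →ₗ[k] A) {n : ℕ} (x : Fin n → A) (r : (free k novSig).carrier n) :
    (diffAlg D).evalLin x (((preSubst diffSig).hom k).toFun n ((novSubst.hom k).toFun n r))
      = (gelfand D).evalLin x r := by
  induction r using free_induction with
  | zero => simp only [map_zero]
  | add r s hr hs => simp only [map_add, hr, hs]
  | smul_mono c t ht =>
    simp only [map_smul, Subst.hom_mono, SigAlg.evalLin_mono, diffAlg_evalTree]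

theorem diffRel_mem_identities (D : A →ₗ[k] A) (hD : ∀ a b : A, D (a * b) = D a * b + a * D b) :
    ∀ s ∈ diffRel k, s.2 ∈ (diffAlg D).identities.sub s.1 := by
  rintro s (rfl | rfl | rfl) <;> rw [SigAlg.mem_identities] <;> intro x <;>
    simp only [SigAlg.eval_eq, map_sub, SigAlg.evalLin_mono, SigAlg.evalTree, diffAlg,
      LinearMap.mul_apply']
  · rw [mul_assoc, sub_self]
  · rw [mul_comm, sub_self]
  · rw [hD]
    abel

end

theorem mem_preRel (r : (free k (preSig diffSig)).carrier 3) :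
    r ∈ preRel (diffPresentation k) ↔
      ((preSubst diffSig).hom k).toFun 3 r ∈ (OpIdeal.span (free k diffSig) (diffRel k)).sub 3 :=
  Submodule.Quotient.mk_eq_zero _

/-- The kernel of the pre-induced homomorphism consists of identities of `a ▷ b = a D(b)`. -/
theorem gelfand_eval_eq_zero {r : (free k novSig).carrier 3}
    (hr : (novSubst.hom k).toFun 3 r ∈ preRel (diffPresentation k))
    {A : Type w} [NonUnitalCommRing A] [Module k A] [IsScalarTower k A A] [SMulCommClass k A A]
    (D : A →ₗ[k] A) (hD : ∀ a b : A, D (a * b) = D a * b + a * D b) (x : Fin 3 → A) :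
    (gelfand D).eval r x = 0 := by
  rw [SigAlg.eval_eq, ← diffAlg_evalLin]
  exact ((diffAlg D).mem_identities _).1
    (OpIdeal.span_le _ (diffRel_mem_identities D hD) 3 ((mem_preRel _).1 hr)) x

/-! ### The Novikov relators lie in the kernel of the pre-induced homomorphism -/

variable (k) in
/-- The relation `(x D(y)) D(z) = x (D(y) D(z))` holds in the operad `𝒟`. -/
theorem assoc_der_der_mem :
    mono k (mulT (mulT (.leaf 0) (derT (.leaf 1))) (derT (.leaf 2)))
      - mono k (mulT (.leaf 0) (mulT (derT (.leaf 1)) (derT (.leaf 2))))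
      ∈ (OpIdeal.span (free k diffSig) (diffRel k)).sub 3 := by
  have h := OpIdeal.subset_span (P := free k diffSig) (S := diffRel k) (.inl rfl)
  -- Insert $D$ in inputs `1` and `2` of the associativity relator; composing with a unary operation
  -- keeps the arity.
  have h₁ := (OpIdeal.span (free k diffSig) (diffRel k)).comp_mem_left (p := 3) (n := 1) rfl 1 _
    (mono k (derT (.leaf 0))) h
  have h₂ := (OpIdeal.span (free k diffSig) (diffRel k)).comp_mem_left (p := 3) (n := 1) rfl 2 _
    (mono k (derT (.leaf 0))) h₁
  simp only [map_sub, LinearMap.sub_apply, comp_mono] at h₂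
  exact h₂

variable (k) in
/-- The relation `(x y) D(D(z)) = x (y D(D(z)))` holds in the operad `𝒟`. -/
theorem assoc_der_sq_mem :
    mono k (mulT (mulT (.leaf 0) (.leaf 1)) (derT (derT (.leaf 2))))
      - mono k (mulT (.leaf 0) (mulT (.leaf 1) (derT (derT (.leaf 2)))))
      ∈ (OpIdeal.span (free k diffSig) (diffRel k)).sub 3 := by
  have h := OpIdeal.subset_span (P := free k diffSig) (S := diffRel k) (.inl rfl)
  have h₁ := (OpIdeal.span (free k diffSig) (diffRel k)).comp_mem_left (p := 3) (n := 1) rfl 2 _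
    (mono k (derT (derT (.leaf 0)))) h
  simp only [map_sub, LinearMap.sub_apply, comp_mono] at h₁
  exact h₁

variable (k) in
/-- The relation `x D(y D(z)) = x (y D(D(z))) + x (D(y) D(z))` holds in the operad `𝒟`. -/
theorem leibniz_mem :
    mono k (mulT (.leaf 0) (derT (mulT (.leaf 1) (derT (.leaf 2)))))
      - mono k (mulT (.leaf 0) (mulT (.leaf 1) (derT (derT (.leaf 2)))))
      - mono k (mulT (.leaf 0) (mulT (derT (.leaf 1)) (derT (.leaf 2))))
      ∈ (OpIdeal.span (free k diffSig) (diffRel k)).sub 3 := by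
  have h := OpIdeal.subset_span (P := free k diffSig) (S := diffRel k) (.inr (.inr rfl))
  -- Insert $D$ in the second input of the Leibniz relator, then graft the result on the second
  -- input of the product, which shifts its labels by one.
  have h₁ := (OpIdeal.span (free k diffSig) (diffRel k)).comp_mem_left (p := 2) (n := 1) rfl 1 _
    (mono k (derT (.leaf 0))) h
  have h₂ := (OpIdeal.span (free k diffSig) (diffRel k)).comp_mem_right (m := 2) (p := 3) rfl 1
    (mono k (mulT (.leaf 0) (.leaf 1))) _ h₁
  simp only [map_sub, LinearMap.sub_apply, comp_mono] at h₂
  exact h₂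

theorem novSubst_rightCommRelator_mem :
    (novSubst.hom k).toFun 3 (rightCommRelator k) ∈ preRel (diffPresentation k) := by
  have h := assoc_der_der_mem k
  have h' := (OpIdeal.span (free k diffSig) (diffRel k)).act_mem (Equiv.swap 1 2) _ h
  simp only [map_sub, act_mono] at h'
  have h₁ := Submodule.sub_mem _ h h'
  rw [mem_preRel]
  simp only [rightCommRelator, map_sub, Subst.hom_mono]
  convert h₁ using 1
  -- Regroup so that the terms $x(y'z')$ and $x(z'y')$ face each other; they are one monomial
  -- because the product is symmetric.
  rw [sub_sub_sub_comm, eq_comm]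
  refine Eq.trans (congrArg₂ (· - ·) rfl (sub_eq_zero.2 (mono_congr _ _ ?_))) (sub_zero _)
  exact .bin _ (.refl _) (.swap (S := diffSig) () _ _)

theorem novSubst_preLieRelator_mem :
    (novSubst.hom k).toFun 3 (preLieRelator k) ∈ preRel (diffPresentation k) := by
  -- In this combination $x(y'z')$ and $x(yz'')$ cancel, leaving $(xy')z'-x(yz')'+(xy)z''$.
  -- Antisymmetrizing in $x,y$ removes the last term.
  have h := Submodule.add_mem _ (Submodule.sub_mem _ (assoc_der_der_mem k) (leibniz_mem k))
    (assoc_der_sq_mem k)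
  have h' := (OpIdeal.span (free k diffSig) (diffRel k)).act_mem (Equiv.swap 0 1) _ h
  have h₁ := Submodule.sub_mem _ h h'
  have e : mono k (mulT (mulT (.leaf 0) (.leaf 1)) (derT (derT (.leaf 2))))
      = mono k (n := 3) (mulT (mulT (.leaf 1) (.leaf 0)) (derT (derT (.leaf 2)))) :=
    mono_congr _ _ (.bin _ (.swap (S := diffSig) () _ _) (.refl _))
  -- Only the three surviving monomials have to be permuted explicitly; the images of the others
  -- cancel formally.
  have c₁ : (free k diffSig).act (Equiv.swap 0 1)
      (mono k (n := 3) (mulT (mulT (.leaf 0) (derT (.leaf 1))) (derT (.leaf 2))))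
      = mono k (mulT (mulT (.leaf 1) (derT (.leaf 0))) (derT (.leaf 2))) := act_mono _ _ _
  have c₂ : (free k diffSig).act (Equiv.swap 0 1)
      (mono k (n := 3) (mulT (.leaf 0) (derT (mulT (.leaf 1) (derT (.leaf 2))))))
      = mono k (mulT (.leaf 1) (derT (mulT (.leaf 0) (derT (.leaf 2))))) := act_mono _ _ _
  have c₃ : (free k diffSig).act (Equiv.swap 0 1)
      (mono k (n := 3) (mulT (mulT (.leaf 0) (.leaf 1)) (derT (derT (.leaf 2)))))
      = mono k (mulT (mulT (.leaf 1) (.leaf 0)) (derT (derT (.leaf 2)))) := act_mono _ _ _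
  simp only [map_sub, map_add, c₁, c₂, c₃] at h₁
  rw [e] at h₁
  rw [mem_preRel]
  simp only [preLieRelator, map_sub, Subst.hom_mono]
  convert h₁ using 1
  refine Eq.trans (b := mono k (mulT (mulT (.leaf 0) (derT (.leaf 1))) (derT (.leaf 2)))
    - mono k (mulT (.leaf 0) (derT (mulT (.leaf 1) (derT (.leaf 2)))))
    - (mono k (mulT (mulT (.leaf 1) (derT (.leaf 0))) (derT (.leaf 2)))
      - mono k (mulT (.leaf 1) (derT (mulT (.leaf 0) (derT (.leaf 2))))))) rfl ?_
  abel

theorem novRel_le_comap :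
    novRel k ≤ (preRel (diffPresentation k)).comap ((novSubst.hom k).toFun 3) := by
  have act : ∀ (σ : Equiv.Perm (Fin 3)) (r : (free k novSig).carrier 3),
      (novSubst.hom k).toFun 3 r ∈ preRel (diffPresentation k) →
        (novSubst.hom k).toFun 3 ((free k novSig).act σ r) ∈ preRel (diffPresentation k) := by
    intro σ r hr
    rw [mem_preRel] at hr ⊢
    rw [Hom.map_act, Hom.map_act]
    exact OpIdeal.act_mem _ σ _ hr
  refine Submodule.span_le.2 ?_
  rintro r ⟨σ, rfl | rfl⟩
  · exact act σ _ novSubst_preLieRelator_mem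
  · exact act σ _ novSubst_rightCommRelator_mem

end

/-! ### Tree monomials of arity three -/

theorem Tree.length_leaves_pos {S : Sig.{v}} {L : Type} (t : Tree S L) : 0 < t.leaves.length := by
  induction t with
  | leaf l => simp [leaves]
  | un ω t ih => exact ih
  | bin θ t s iht ihs =>
    simp only [leaves, List.length_append]
    omega

theorem novTree_eq_leaf {L : Type} (t : Tree novSig L) (h : t.leaves.length = 1) :
    ∃ a, t = .leaf a := by
  cases t with
  | leaf l => exact ⟨l, rfl⟩
  | un ω t => exact nomatch ω
  | bin θ t s =>
    have h₁ := t.length_leaves_pos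
    have h₂ := s.length_leaves_pos
    simp only [Tree.leaves, List.length_append] at h
    omega

/-- Exchanging branches turns the opposite generator into `▷`, so normal forms need only `▷`. -/
theorem novTree_bin_equivalent {L : Type} (θ : NovGen) (t s : Tree novSig L) :
    (Tree.bin (S := novSig) θ t s).Equivalent (novT t s) ∨
      (Tree.bin (S := novSig) θ t s).Equivalent (novT s t) := by
  cases θ with
  | op => exact .inl (.refl _)
  | opp => exact .inr (.swap (S := novSig) NovGen.opp _ _)

theorem novTree_equivalent_of_two {L : Type} (t : Tree novSig L) (h : t.leaves.length = 2) :
    ∃ a b, t.Equivalent (novT (.leaf a) (.leaf b)) := by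
  cases t with
  | leaf l => simp [Tree.leaves] at h
  | un ω t => exact nomatch ω
  | bin θ t s =>
    have h₁ := t.length_leaves_pos
    have h₂ := s.length_leaves_pos
    simp only [Tree.leaves, List.length_append] at h
    obtain ⟨a, rfl⟩ := novTree_eq_leaf t (by omega)
    obtain ⟨b, rfl⟩ := novTree_eq_leaf s (by omega)
    rcases novTree_bin_equivalent θ (.leaf a) (.leaf b) with h | h
    · exact ⟨a, b, h⟩
    · exact ⟨b, a, h⟩

theorem novTree_equivalent_of_three {L : Type} (t : Tree novSig L) (h : t.leaves.length = 3) :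
    ∃ a b c, t.Equivalent (novT (novT (.leaf a) (.leaf b)) (.leaf c)) ∨
      t.Equivalent (novT (.leaf a) (novT (.leaf b) (.leaf c))) := by
  cases t with
  | leaf l => simp [Tree.leaves] at h
  | un ω t => exact nomatch ω
  | bin θ t s =>
    have h₁ := t.length_leaves_pos
    have h₂ := s.length_leaves_pos
    simp only [Tree.leaves, List.length_append] at h
    have h₃ : t.leaves.length = 1 ∧ s.leaves.length = 2 ∨
        t.leaves.length = 2 ∧ s.leaves.length = 1 := by omega
    rcases h₃ with ⟨ht, hs⟩ | ⟨ht, hs⟩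
    · obtain ⟨a, rfl⟩ := novTree_eq_leaf t ht
      obtain ⟨b, c, e⟩ := novTree_equivalent_of_two s hs
      rcases novTree_bin_equivalent θ (.leaf a) s with h | h
      · exact ⟨a, b, c, .inr (h.trans (.bin _ (.refl _) e))⟩
      · exact ⟨b, c, a, .inl (h.trans (.bin _ e (.refl _)))⟩
    · obtain ⟨a, rfl⟩ := novTree_eq_leaf s hs
      obtain ⟨b, c, e⟩ := novTree_equivalent_of_two t ht
      rcases novTree_bin_equivalent θ t (.leaf a) with h | h
      · exact ⟨b, c, a, .inl (h.trans (.bin _ e (.refl _)))⟩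
      · exact ⟨a, b, c, .inr (h.trans (.bin _ (.refl _) e))⟩

theorem Tree.Equivalent.perm_leaves {S : Sig.{v}} {L : Type} {t s : Tree S L}
    (h : t.Equivalent s) : t.leaves.Perm s.leaves := by
  induction h with
  | refl t => exact .refl _
  | symm _ ih => exact ih.symm
  | trans _ _ ih₁ ih₂ => exact ih₁.trans ih₂
  | un ω _ ih => exact ih
  | bin θ _ _ ih₁ ih₂ => exact ih₁.append ih₂
  | swap θ t s => exact List.perm_append_comm

theorem Tree.Equivalent.isLabelled {S : Sig.{v}} {L : Type} {t s : Tree S L}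
    (h : t.Equivalent s) (ht : t.IsLabelled) : s.IsLabelled :=
  ⟨h.perm_leaves.nodup_iff.1 ht.1, fun l => h.perm_leaves.mem_iff.1 (ht.2 l)⟩

theorem Tree.IsLabelled.length_leaves {S : Sig.{v}} {n : ℕ} {t : Tree S (Fin n)}
    (ht : t.IsLabelled) : t.leaves.length = n := by
  rw [← List.toFinset_card_of_nodup ht.1,
    Finset.eq_univ_iff_forall.2 fun l => List.mem_toFinset.2 (ht.2 l), Finset.card_fin]

section

variable (k : Type u) [CommRing k]

/-- The monomial `(σ 0 ▷ σ 1) ▷ σ 2`. -/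
def novLeft (σ : Equiv.Perm (Fin 3)) : (free k novSig).carrier 3 :=
  mono k ((novT (novT (.leaf 0) (.leaf 1)) (.leaf 2)).map σ)
    (Tree.IsLabelled.map (by decide) σ)

/-- The monomial `σ 0 ▷ (σ 1 ▷ σ 2)`. -/
def novRight (σ : Equiv.Perm (Fin 3)) : (free k novSig).carrier 3 :=
  mono k ((novT (.leaf 0) (novT (.leaf 1) (.leaf 2))).map σ)
    (Tree.IsLabelled.map (by decide) σ)

variable {k}

/-- The three leaves split as $1+2$ or $2+1$, and each opposite vertex can be flipped. Since
equivalence preserves the multiset of labels, the labels of the normal form are distinct and define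
a permutation. -/
theorem mono_eq_novLeft_or_novRight (t : Tree novSig (Fin 3)) (ht : t.IsLabelled) :
    ∃ σ, mono k t ht = novLeft k σ ∨ mono k t ht = novRight k σ := by
  obtain ⟨a, b, c, h⟩ := novTree_equivalent_of_three t ht.length_leaves
  have nd : [a, b, c].Nodup := by
    rcases h with h | h
    · exact (h.isLabelled ht).1
    · exact (h.isLabelled ht).1
  have inj : Function.Injective ![a, b, c] := by
    simp only [List.nodup_cons, List.mem_cons, List.not_mem_nil, or_false, not_or] at nd
    intro i j hij
    fin_cases i <;> fin_cases j <;> simp_all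
  refine ⟨Equiv.ofBijective _ (Finite.injective_iff_bijective.1 inj), ?_⟩
  exact h.imp (fun h => mono_congr _ _ h) (fun h => mono_congr _ _ h)

theorem novLeft_sub_mem (σ : Equiv.Perm (Fin 3)) :
    novLeft k σ - novLeft k (σ * Equiv.swap 1 2) ∈ novRel k := by
  -- The right action of a permutation relabels leaves by its inverse, hence `σ.symm`.
  refine Submodule.subset_span ⟨σ.symm, .inr ?_⟩
  rw [rightCommRelator, map_sub, act_mono, act_mono]
  rfl

theorem novLeft_sub_novRight_sub_mem (σ : Equiv.Perm (Fin 3)) :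
    novLeft k σ - novRight k σ - (novLeft k (σ * Equiv.swap 0 1) - novRight k (σ * Equiv.swap 0 1))
      ∈ novRel k := by
  refine Submodule.subset_span ⟨σ.symm, .inl ?_⟩
  rw [preLieRelator, map_sub, map_sub, map_sub, act_mono, act_mono, act_mono, act_mono]
  rfl

/-! ### Differential polynomials -/

variable (k)

/-- The differential polynomials in three variables: `X (i, n)` is the `n`-th derivative of the
variable `i`. -/
abbrev DiffPoly : Type u := MvPolynomial (Fin 3 × ℕ) k

/-- The derivation of the algebra of differential polynomials. -/
def diffPolyDer : Derivation k (DiffPoly k) (DiffPoly k) :=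
  MvPolynomial.mkDerivation k fun p => MvPolynomial.X (p.1, p.2 + 1)

theorem diffPolyDer_X (p : Fin 3 × ℕ) :
    diffPolyDer k (MvPolynomial.X p) = MvPolynomial.X (p.1, p.2 + 1) :=
  MvPolynomial.mkDerivation_X _ _ _

/-- The exponent of the differential monomial `σ 0 · D(σ 1) · D(σ 2)`. -/
def expLeft (σ : Equiv.Perm (Fin 3)) : Fin 3 × ℕ →₀ ℕ :=
  Finsupp.single (σ 0, 0) 1 + Finsupp.single (σ 1, 1) 1 + Finsupp.single (σ 2, 1) 1

/-- The exponent of the differential monomial `σ 0 · σ 1 · D²(σ 2)`. -/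
def expRight (σ : Equiv.Perm (Fin 3)) : Fin 3 × ℕ →₀ ℕ :=
  Finsupp.single (σ 0, 0) 1 + Finsupp.single (σ 1, 0) 1 + Finsupp.single (σ 2, 2) 1

theorem eq_or_eq_of_expLeft_eq {σ τ : Equiv.Perm (Fin 3)} (h : expLeft τ = expLeft σ) :
    τ = σ ∨ τ = σ * Equiv.swap 1 2 := by
  -- The only underived variable of $ab'c'$ is $a$, so `τ 0 = σ 0`; the rest is a finite check in
  -- $S_3$.
  have h₀ := DFunLike.congr_fun h (σ 0, 0)
  simp [expLeft, Finsupp.single_apply, -EmbeddingLike.apply_eq_iff_eq] at h₀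
  clear h
  revert σ τ
  decide

theorem eq_or_eq_of_expRight_eq {σ τ : Equiv.Perm (Fin 3)} (h : expRight τ = expRight σ) :
    τ = σ ∨ τ = σ * Equiv.swap 0 1 := by
  -- The twice derived variable determines `τ 2 = σ 2`.
  have h₀ := DFunLike.congr_fun h (σ 2, 2)
  simp [expRight, Finsupp.single_apply] at h₀
  clear h
  revert σ τ
  decide

/-- A second derivative occurs in only one of the two types, so `liftExp` never confuses them. -/
theorem expLeft_ne_expRight (σ τ : Equiv.Perm (Fin 3)) : expLeft τ ≠ expRight σ := by
  intro h
  have h₀ := DFunLike.congr_fun h (σ 2, 2)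
  simp [expLeft, expRight] at h₀

theorem evalLin_novLeft (σ : Equiv.Perm (Fin 3)) :
    (gelfand (diffPolyDer k).toLinearMap).evalLin (fun i => MvPolynomial.X (i, 0)) (novLeft k σ)
      = MvPolynomial.monomial (expLeft σ) 1 := by
  rw [novLeft, SigAlg.evalLin_mono]
  simp [Tree.map, Tree.bind, SigAlg.evalTree, gelfand, diffPolyDer_X]
  simp [MvPolynomial.X, MvPolynomial.monomial_mul, expLeft]

theorem evalLin_novRight (σ : Equiv.Perm (Fin 3)) :
    (gelfand (diffPolyDer k).toLinearMap).evalLin (fun i => MvPolynomial.X (i, 0)) (novRight k σ)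
      = MvPolynomial.monomial (expLeft σ) 1 + MvPolynomial.monomial (expRight σ) 1 := by
  rw [novRight, SigAlg.evalLin_mono]
  simp [Tree.map, Tree.bind, SigAlg.evalTree, gelfand, diffPolyDer_X]
  -- Put the two Leibniz terms and their factors in the order used by `expLeft` and `expRight`.
  rw [mul_add, add_comm, mul_comm (MvPolynomial.X (σ 2, 1))]
  simp [MvPolynomial.X, MvPolynomial.monomial_mul, expLeft, expRight, add_assoc]

/-! ### Lifting differential polynomials to Novikov polynomials -/

open Classical in
/-- A Novikov polynomial that represents a given differential monomial. -/
def liftExp (e : Fin 3 × ℕ →₀ ℕ) : (free k novSig).carrier 3 :=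
  -- Two permutations can give the same exponent; the choice is harmless modulo `novRel`.
  if h : ∃ σ, expLeft σ = e then novLeft k h.choose
  else if h : ∃ σ, expRight σ = e then novRight k h.choose - novLeft k h.choose
  -- Any value would do: other exponents do not occur when elements of arity three are evaluated at
  -- the variables.
  else 0

/-- The chosen permutation differs from `σ` at most by exchanging the two derived variables, which
is right commutativity. -/
theorem liftExp_expLeft (σ : Equiv.Perm (Fin 3)) :
    liftExp k (expLeft σ) - novLeft k σ ∈ novRel k := by
  have h : ∃ τ, expLeft τ = expLeft σ := ⟨σ, rfl⟩
  rw [liftExp, dif_pos h]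
  rcases eq_or_eq_of_expLeft_eq h.choose_spec with e | e <;> rw [e]
  · rw [sub_self]
    exact Submodule.zero_mem _
  · rw [← neg_sub]
    exact Submodule.neg_mem _ (novLeft_sub_mem σ)

/-- The chosen permutation differs from `σ` at most by exchanging the two underived variables, which
is the symmetry of the associator. -/
theorem liftExp_expRight (σ : Equiv.Perm (Fin 3)) :
    liftExp k (expRight σ) - (novRight k σ - novLeft k σ) ∈ novRel k := by
  have h : ∃ τ, expRight τ = expRight σ := ⟨σ, rfl⟩
  rw [liftExp, dif_neg fun ⟨τ, hτ⟩ => expLeft_ne_expRight σ τ hτ, dif_pos h]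
  rcases eq_or_eq_of_expRight_eq h.choose_spec with e | e <;> rw [e]
  · rw [sub_self]
    exact Submodule.zero_mem _
  · convert novLeft_sub_novRight_sub_mem (k := k) σ using 1
    abel

/-- The linear extension of `liftExp`. -/
def liftPoly : DiffPoly k →ₗ[k] (free k novSig).carrier 3 :=
  (MvPolynomial.basisMonomials (Fin 3 × ℕ) k).constr k (liftExp k)

theorem liftPoly_monomial (e : Fin 3 × ℕ →₀ ℕ) :
    liftPoly k (MvPolynomial.monomial e 1) = liftExp k e := by
  have h : MvPolynomial.monomial e (1 : k) = MvPolynomial.basisMonomials (Fin 3 × ℕ) k e := by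
    rw [MvPolynomial.coe_basisMonomials]
  rw [h]
  exact Module.Basis.constr_basis _ _ _ _

variable {k}

/-- By linearity it is enough to treat the two types of monomials. For the right-bracketed one, the
two lifts add up to `novRight` because the `novLeft` parts cancel. -/
theorem liftPoly_evalLin_sub_mem (r : (free k novSig).carrier 3) :
    liftPoly k ((gelfand (diffPolyDer k).toLinearMap).evalLin
      (fun i => MvPolynomial.X (i, 0)) r) - r ∈ novRel k := by
  induction r using free_induction with
  | zero => simp only [map_zero, sub_self, Submodule.zero_mem]
  | add r s hr hs =>
    simp only [map_add]
    rw [add_sub_add_comm]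
    exact Submodule.add_mem _ hr hs
  | smul_mono c t ht =>
    simp only [map_smul]
    rw [← smul_sub]
    refine Submodule.smul_mem _ c ?_
    obtain ⟨σ, e | e⟩ := mono_eq_novLeft_or_novRight (k := k) t ht <;> rw [e]
    · rw [evalLin_novLeft, liftPoly_monomial]
      exact liftExp_expLeft k σ
    · rw [evalLin_novRight, map_add, liftPoly_monomial, liftPoly_monomial]
      convert Submodule.add_mem _ (liftExp_expLeft k σ) (liftExp_expRight k σ) using 1
      abel

/-- A Novikov polynomial of arity three that vanishes on all commutative differential algebras is
a consequence of the Novikov axioms. -/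
theorem mem_novRel_of_eval_eq_zero {r : (free k novSig).carrier 3}
    (h : ∀ x : Fin 3 → DiffPoly k, (gelfand (diffPolyDer k).toLinearMap).eval r x = 0) :
    r ∈ novRel k := by
  have h₁ := liftPoly_evalLin_sub_mem r
  -- Only the evaluation at the three variables themselves is used.
  rw [← SigAlg.eval_eq, h, map_zero, zero_sub] at h₁
  exact (Submodule.neg_mem_iff _).1 h₁

theorem novRel_eq_comap :
    novRel k = (preRel (diffPresentation k)).comap ((novSubst.hom k).toFun 3) := by
  refine le_antisymm novRel_le_comap fun r hr => mem_novRel_of_eval_eq_zero fun x => ?_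
  exact gelfand_eval_eq_zero hr _ (fun a b => by simp [mul_comm, add_comm]) x

end

end InducedOperad

end

/-! ### The three claims of the corollary -/

open InducedOperad in
theorem corollary3p4 (k : Type u) [Field k] :
    novRel k = (preRel (diffPresentation k)).comap ((novSubst.hom k).toFun 3) ∧
    (∃ φ : Hom (novPresentation k).operad (prePresentation (diffPresentation k)).operad,
      φ.IsIso ∧
      φ.toFun 2 ((novPresentation k).gen NovGen.op)
        = (prePresentation (diffPresentation k)).gen (PreGen.prec () ()) ∧
      φ.toFun 2 ((novPresentation k).gen NovGen.opp)
        = (prePresentation (diffPresentation k)).gen (PreGen.succ () ())) ∧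
    (∀ r : (free k novSig).carrier 3, r ∈ novRel k ↔
      ∀ (A : Type u) [NonUnitalCommRing A] [Module k A] [IsScalarTower k A A]
        [SMulCommClass k A A] (D : A →ₗ[k] A),
        (∀ a b : A, D (a * b) = D a * b + a * D b) →
          ∀ x : Fin 3 → A, (gelfand D).eval r x = 0) := by
  have hgf := Subst.hom_hom (k := k) novSubst novSubstInv
    fun _ t => novSubstInv_tree_novSubst_tree t
  have hfg := Subst.hom_hom (k := k) novSubstInv novSubst
    fun _ t => novSubst_tree_novSubstInv_tree t
  have hI : ∀ n, (OpIdeal.span _ (novPresentation k).rel).sub n ≤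
      ((OpIdeal.span _ (prePresentation (diffPresentation k)).rel).sub n).comap
        ((novSubst.hom k).toFun n) := by
    refine OpIdeal.span_le (OpIdeal.comap (novSubst.hom k) _) ?_
    rintro _ ⟨r, hr, rfl⟩
    exact OpIdeal.subset_span ⟨_, novRel_le_comap hr, rfl⟩
  have hJ : ∀ n, (OpIdeal.span _ (prePresentation (diffPresentation k)).rel).sub n ≤
      ((OpIdeal.span _ (novPresentation k).rel).sub n).comap
        ((novSubstInv.hom k).toFun n) := by
    refine OpIdeal.span_le (OpIdeal.comap (novSubstInv.hom k) _) ?_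
    rintro _ ⟨r, hr, rfl⟩
    refine OpIdeal.subset_span ⟨_, ?_, rfl⟩
    -- Here the nontrivial inclusion enters: `r` is the renaming of its inverse image, which
    -- therefore lies in `novRel`.
    exact novRel_eq_comap.ge ((congrArg (· ∈ preRel (diffPresentation k)) (hfg 3 r)).mpr hr)
  refine ⟨novRel_eq_comap,
    ⟨(novSubst.hom k).quotMap _ _ hI, Hom.quotMap_isIso _ (novSubstInv.hom k) _ _ hI hJ hgf hfg,
      ?_, ?_⟩, fun r => ⟨fun hr A _ _ _ _ D hD x => ?_, fun h => ?_⟩⟩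
  · exact congrArg Submodule.Quotient.mk (Subst.hom_mono _ _ _)
  · exact congrArg Submodule.Quotient.mk (Subst.hom_mono _ _ _)
  · exact gelfand_eval_eq_zero (novRel_le_comap hr) D hD x
  -- One test algebra suffices, the differential polynomials in three variables, which live in the
  -- same universe as `k`.
  · exact mem_novRel_of_eval_eq_zero
      (h (DiffPoly k) _ fun a b => by simp [mul_comm, add_comm])
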